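/- **Setting.** For $l=1,2$ let $X_l\subset\mathbb R^{m_l}$ be compact and convex, $\|\cdot\|$ a norm on $\mathbb R^{m_l}$ with dual norm $\|\cdot\|_*$, $\mathcal V_l$ a nonempty set of $n_l$ agents, and $O_l\supseteq X_l$ an open set. Each agent $i\in\mathcal V_l$ has the cost $f_{l,i}(x_1,x_2)=\mathbb E[\Psi_{l,i}(x_1,x_2;\xi)]$, where $\xi$ is a random vector in $\mathbb R^d$ and the costs are defined for $x_l\in O_l$, $x_{3-l}\in X_{3-l}$. On $X_1\times X_2$, $f_{l,i}$ is continuous, convex in $x_l$ and concave in $x_{3-l}$, and $$U:=\frac1{n_1}\sum_{i}f_{1,i}=-\frac1{n_2}\sum_{j}f_{2,j}.$$ The subdifferential $\partial_l$ is taken in the variable $x_l$ over $O_l$: $g\in\partial h(p)$ iff $h(y)\ge h(p)+\langle g,y-p\rangle$ for all $y\in O_l$. Let $\psi_l$ be differentiable and $1$-strongly convex on $X_l$, $D_{\psi_l}(x,p)=\psi_l(x)-\psi_l(p)-\langle\nabla\psi_l(p),x-p\rangle$ and $P^l_x(y)=\arg\min_{x'\in X_l}\{\langle y,x-x'\rangle+D_{\psi_l}(x',x)\}$.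 *Communication.* There is $\kappa\in(0,1)$ such that for each $l$ the mixing matrices $W_l(t)=(w_{l,ij}(t))$ of digraphs $(\mathcal V_l,\mathcal E_l(t))$, $t\ge0$, are doubly stochastic (rows and columns sum to $1$), $w_{l,ij}(t)\ge\kappa$ if $(j,i)\in\mathcal E_l(t)$ and $w_{l,ij}(t)=0$ otherwise, $(i,i)\in\mathcal E_l(t)$ for all $i$, and for some integer $B_l\ge1$ the union of the graphs over any $B_l$ consecutive times is strongly connected. The weights $w_{12,ij}(t)\ge0$ ($i\in\mathcal V_l$, $j\in\mathcal V_{3-l}$) vanish unless $j$ is a neighbour of $i$ at time $t$ in the bipartite network that connects the two networks, and satisfy $\sum_jw_{12,ij}(t)=1$. *Algorithm (D-SMD) with step sizes $\alpha(t)$.* Start with $x_{l,i}(0)\in X_l$ (possibly random). For $t\ge0$, $l=1,2$, $i\in\mathcal V_l$, put $$v_{l,i}(t)=\sum_jw_{l,ij}(t)x_{l,j}(t),\qquad u_{3-l,i}(t)=\sum_jw_{12,ij}(t)x_{3-l,j}(t),$$ receive a sampled subgradient $\hat g_{l,i}(t)\in\partial_l\Psi_{l,i}(\cdot;\xi_{l,i}(t))$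 at $x_l=v_{l,i}(t)$, $x_{3-l}=u_{3-l,i}(t)$, where the $\xi_{l,i}(t)$ are independent copies of $\xi$, and set $x_{l,i}(t+1)=P^l_{v_{l,i}(t)}(-\alpha(t)\hat g_{l,i}(t))$. Let $\mathcal F_t=\sigma\{x_{l,i}(0),\xi_{l,i}(s):l=1,2,\ i\in\mathcal V_l,\ 0\le s\le t-1\}$; $\hat g_{l,i}(t)$ is $\mathcal F_{t+1}$-measurable. *Assumptions.* There are $L,\nu_1,\nu_2>0$ such that for all $l$, $i$, $t$: (A1) $|f_{l,i}(x_1,x_2)-f_{l,i}(x_1',x_2')|\le L(\|x_1-x_1'\|+\|x_2-x_2'\|)$ on $X_1\times X_2$, and for each fixed $x_{3-l}\in X_{3-l}$ the function $f_{l,i}$ is $L$-Lipschitz in $x_l\in O_l$. (A2) $\hat g_{l,i}(t)$ is integrable, $\mathbb E[\hat g_{l,i}(t)\mid\mathcal F_t]=g_{l,i}(t)$, where $g_{l,i}(t)$ is a subgradient in $\partial_lf_{l,i}$ at $x_l=v_{l,i}(t)$, $x_{3-l}=u_{3-l,i}(t)$, and $\|g_{l,i}(t)-\hat g_{l,i}(t)\|_*^2$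 is integrable with $\mathbb E[\|g_{l,i}(t)-\hat g_{l,i}(t)\|_*^2\mid\mathcal F_t]\le\nu_l^2$. (A3) $D_{\psi_l}(x,y)$ is convex in $y\in X_l$, and $x_k\to x$ in $X_l$ implies $D_{\psi_l}(x_k,x)\to0$. **Theorem.** Let $\eta>0$ and let each $f_{1,i}$ be $\eta$-strongly convex in $x_1\in X_1$ with respect to $\psi_1$ for every $x_2\in X_2$, i.e. $f_{1,i}(x,x_2)-f_{1,i}(y,x_2)-\langle\lambda,x-y\rangle\ge\eta D_{\psi_1}(x,y)$ for all $x,y\in X_1$ and $\lambda\in\partial_1f_{1,i}(y,x_2)$. Let $\alpha(t)=\frac1{\eta(t+1)}$. Then for every $i\in\mathcal V_1$ and every $T\ge1$ the pseudo regret $$\bar R_1^{(i)}(T)=\mathbb E\Big[\sum_{t=1}^TU(x_{1,i}(t),u_{2,i}(t))\Big]-\min_{x_1\in X_1}\mathbb E\Big[\sum_{t=1}^TU(x_1,u_{2,i}(t))\Big]$$ of D-SMD satisfies $$\bar R_1^{(i)}(T)\le\frac1\eta\sum_{l=1}^2(L+\nu_l)\Big(9L+\nu_l+\frac{4Ln_l\Gamma_l}{1-\theta_l}\Big)(1+\log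 T)+4L\sum_{l=1}^2\frac{n_l\Gamma_l\Lambda_l}{1-\theta_l},$$ where $\Gamma_l=(1-\kappa/4n_l^2)^{-2}$, $\theta_l=(1-\kappa/4n_l^2)^{1/B_l}$ and $\Lambda_l=\mathbb E[\max_{i\in\mathcal V_l}\|x_{l,i}(0)\|]$ (which is $\max_i\|x_{l,i}(0)\|$ for deterministic initial points). Consequently there is a constant $K$ with $\bar R_1^{(i)}(T)\le K\log T$ for all $i\in\mathcal V_1$ and all $T\ge2$. -/

import Mathlib

open MeasureTheory ProbabilityTheory Filter Topology

namespace DSMD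

section Convex

variable {E : Type*} [NormedAddCommGroup E] [NormedSpace ℝ E]

/-- The Bregman divergence `D_ψ(x, p) = ψ(x) - ψ(p) - ⟨∇ψ(p), x - p⟩` of a regularizer `ψ` that is
differentiable on the convex set `X`. For `x, p ∈ X` the value of a derivative of `ψ` within `X`
in the direction `x - p` is uniquely determined, even if `X` has empty interior. -/
noncomputable def bregman (X : Set E) (ψ : E → ℝ) (x p : E) : ℝ :=
  ψ x - ψ p - fderivWithin ℝ ψ X p (x - p)

/-- The subdifferential at `p` of a function `h` with domain `O`; subgradients live in the dual
space, whose operator norm is the dual norm. -/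
def subdiff (O : Set E) (h : E → ℝ) (p : E) : Set (StrongDual ℝ E) :=
  {g | ∀ y ∈ O, h p + g (y - p) ≤ h y}

/-- `q` is the value at `y` of the prox-mapping with base point `p`:
`q ∈ argmin_{x' ∈ X} ⟨y, p - x'⟩ + D_ψ(x', p)`. -/
def IsProx (X : Set E) (ψ : E → ℝ) (p : E) (y : StrongDual ℝ E) (q : E) : Prop :=
  q ∈ X ∧ IsMinOn (fun x' => y (p - x') + bregman X ψ x' p) X q

/-- `f` (with domain `O`) is `η`-strongly convex over `X` with respect to `ψ`. -/
def StronglyConvexWrt (O X : Set E) (ψ : E → ℝ) (η : ℝ) (f : E → ℝ) : Prop :=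
  ∀ x ∈ X, ∀ y ∈ X, ∀ lam ∈ subdiff O f y,
    η * bregman X ψ x y ≤ f x - f y - lam (x - y)

end Convex

section Mixing

/-- Mixing matrices `W t` of a directed graph sequence on `V`; `edge t j i` means that `(j, i)` is
an edge at time `t`, i.e. `i` receives information from `j`. -/
structure IsMixing {V : Type*} [Fintype V] (κ : ℝ) (B : ℕ) (edge : ℕ → V → V → Prop)
    (W : ℕ → Matrix V V ℝ) : Prop where
  weight_ge : ∀ t i j, edge t j i → κ ≤ W t i j
  weight_eq_zero : ∀ t i j, ¬ edge t j i → W t i j = 0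
  row_sum : ∀ t i, ∑ j, W t i j = 1
  col_sum : ∀ t j, ∑ i, W t i j = 1
  /-- every agent uses its own estimate -/
  self_loop : ∀ t i, edge t i i
  one_le : 1 ≤ B
  /-- the union graph over any `B` consecutive times is strongly connected -/
  strongly_connected : ∀ k i j,
    Relation.ReflTransGen (fun a b => ∃ t, k ≤ t ∧ t < k + B ∧ edge t a b) i j

/-- Weights `C t i j` with which agent `i ∈ V` averages the estimates that it receives from the
agents `j ∈ V'` of the other network. -/
structure IsCrossMixing {V V' : Type*} [Fintype V'] (edge : ℕ → V' → V → Prop)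
    (C : ℕ → Matrix V V' ℝ) : Prop where
  nonneg : ∀ t i j, 0 ≤ C t i j
  weight_eq_zero : ∀ t i j, ¬ edge t j i → C t i j = 0
  row_sum : ∀ t i, ∑ j, C t i j = 1

/-- `Γ = (1 - κ / (4 n²))⁻²`. -/
noncomputable def Gam (κ : ℝ) (n : ℕ) : ℝ := (1 - κ / (4 * (n : ℝ) ^ 2)) ^ (-2 : ℤ)

/-- `θ = (1 - κ / (4 n²))^(1/B)`. -/
noncomputable def theta (κ : ℝ) (n B : ℕ) : ℝ := (1 - κ / (4 * (n : ℝ) ^ 2)) ^ ((1 : ℝ) / (B : ℝ))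

end Mixing

/-- The data of one of the two networks: `E`, `V` are its decision space and its agents, `F`, `V'`
those of the opposing network. In all costs the network's own decision variable comes first. -/
structure Network (E F V V' : Type*) (d : ℕ) where
  /-- strategy set -/
  X : Set E
  /-- open neighbourhood of the strategy set on which the costs are defined as functions of the
  network's own variable, and with respect to which subgradients are taken -/
  O : Set E
  /-- sample costs: own decision, opposing decision, value of the random vector -/
  sample : V → E → F → (Fin d → ℝ) → ℝ
  /-- regularizer -/
  ψ : E → ℝ
  /-- edges inside the network -/
  edge : ℕ → V → V → Prop
  /-- mixing matrices inside the network -/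
  W : ℕ → Matrix V V ℝ
  /-- edges from the opposing network into this one -/
  crossEdge : ℕ → V' → V → Prop
  /-- mixing weights for the information from the opposing network -/
  C : ℕ → Matrix V V' ℝ

/-- The random objects of a run of the algorithm in one network, at time `t` and for agent `i`. -/
structure Run (Ω E V : Type*) [NormedAddCommGroup E] [NormedSpace ℝ E] (d : ℕ) where
  /-- estimates -/
  x : ℕ → V → Ω → E
  /-- samples of the random vector -/
  ξ : ℕ → V → Ω → (Fin d → ℝ)
  /-- sampled subgradients -/
  ghat : ℕ → V → Ω → StrongDual ℝ E
  /-- subgradients of the expected costs -/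
  g : ℕ → V → Ω → StrongDual ℝ E

section Game

variable {Ω : Type*} [MeasurableSpace Ω] {d : ℕ}
  {E F V V' : Type*} [NormedAddCommGroup E] [NormedSpace ℝ E]
  [NormedAddCommGroup F] [NormedSpace ℝ F] [Fintype V] [Fintype V']

/-- The expected cost `f_i(x, y) = 𝔼[sample_i(x, y; ξ)]` of agent `i`. -/
noncomputable def Network.cost (N : Network E F V V' d) (P : Measure Ω) (ξ : Ω → Fin d → ℝ)
    (i : V) (x : E) (y : F) : ℝ :=
  ∫ ω, N.sample i x y (ξ ω) ∂P

/-- The average `(1/n) ∑ f_i(x, y)` of the expected costs. -/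
noncomputable def Network.avgCost (N : Network E F V V' d) (P : Measure Ω) (ξ : Ω → Fin d → ℝ)
    (x : E) (y : F) : ℝ :=
  (1 / (Fintype.card V : ℝ)) * ∑ i, N.cost P ξ i x y

/-- Standing assumptions on one network; `X'` is the strategy set of the opposing network. -/
structure Network.IsValid (N : Network E F V V' d) (X' : Set F) (κ : ℝ) (B : ℕ)
    (P : Measure Ω) (ξ : Ω → Fin d → ℝ) : Prop where
  isCompact : IsCompact N.X
  convex : Convex ℝ N.X
  isOpen : IsOpen N.O
  subset : N.X ⊆ N.O
  integrable : ∀ i, ∀ x ∈ N.O, ∀ y ∈ X', Integrable (fun ω => N.sample i x y (ξ ω)) P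
  continuous_cost : ∀ i, ContinuousOn (fun z : E × F => N.cost P ξ i z.1 z.2) (N.X ×ˢ X')
  convex_cost : ∀ i, ∀ y ∈ X', ConvexOn ℝ N.X (fun x => N.cost P ξ i x y)
  concave_cost : ∀ i, ∀ x ∈ N.X, ConcaveOn ℝ X' (fun y => N.cost P ξ i x y)
  differentiable_reg : DifferentiableOn ℝ N.ψ N.X
  strongConvex_reg : StrongConvexOn N.X 1 N.ψ
  mixing : IsMixing κ B N.edge N.W
  crossMixing : IsCrossMixing N.crossEdge N.C

/-- Lipschitz continuity of the expected costs, on the product of the strategy sets and, in the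
network's own variable, on the neighbourhood `O` of its strategy set. -/
structure Network.LipschitzCosts (N : Network E F V V' d) (X' : Set F) (P : Measure Ω)
    (ξ : Ω → Fin d → ℝ) (L : ℝ) : Prop where
  lipschitz : ∀ i, ∀ x ∈ N.X, ∀ x' ∈ N.X, ∀ y ∈ X', ∀ y' ∈ X',
    |N.cost P ξ i x y - N.cost P ξ i x' y'| ≤ L * (‖x - x'‖ + ‖y - y'‖)
  lipschitz_own : ∀ i, ∀ x ∈ N.O, ∀ x' ∈ N.O, ∀ y ∈ X',
    |N.cost P ξ i x y - N.cost P ξ i x' y| ≤ L * ‖x - x'‖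

/-- The Bregman divergence is convex in its second argument and satisfies reciprocity. -/
structure Network.RegularDivergence (N : Network E F V V' d) : Prop where
  convex_right : ∀ x ∈ N.X, ConvexOn ℝ N.X (fun y => bregman N.X N.ψ x y)
  reciprocity : ∀ x ∈ N.X, ∀ s : ℕ → E, (∀ k, s k ∈ N.X) → Tendsto s atTop (𝓝 x) →
    Tendsto (fun k => bregman N.X N.ψ (s k) x) atTop (𝓝 0)

/-- `v_i(t) = ∑_j w_ij(t) x_j(t)`: average over the agent's own network. -/
def Network.v (N : Network E F V V' d) (R : Run Ω E V d) (t : ℕ) (i : V) (ω : Ω) : E :=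
  ∑ j, N.W t i j • R.x t j ω

/-- `u_i(t) = ∑_j w_{12,ij}(t) x'_j(t)`: the average that agent `i` of network `N` forms of the
estimates in the opposing network (whose run is `R'`). -/
def Network.u (N : Network E F V V' d) (R' : Run Ω F V' d) (t : ℕ) (i : V) (ω : Ω) : F :=
  ∑ j, N.C t i j • R'.x t j ω

/-- The information `ℱ_t = σ{x_{l,i}(0), ξ_{l,i}(s) : l = 1,2, i ∈ V_l, 0 ≤ s ≤ t - 1}`. -/
@[reducible] def past [MeasurableSpace E] [MeasurableSpace F] (R : Run Ω E V d) (R' : Run Ω F V' d) (t : ℕ) :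
    MeasurableSpace Ω :=
  (⨆ i, MeasurableSpace.comap (R.x 0 i) inferInstance) ⊔
  (⨆ i, MeasurableSpace.comap (R'.x 0 i) inferInstance) ⊔
  (⨆ s ∈ Set.Iio t, ⨆ i, MeasurableSpace.comap (R.ξ s i) inferInstance) ⊔
  (⨆ s ∈ Set.Iio t, ⨆ i, MeasurableSpace.comap (R'.ξ s i) inferInstance)

/-- The part of the algorithm that is carried out in one network, with step sizes `α`; `ℱ` is the
information flow. -/
structure Network.Follows (N : Network E F V V' d) [MeasurableSpace E] (ℱ : ℕ → MeasurableSpace Ω)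
    (R : Run Ω E V d) (R' : Run Ω F V' d) (α : ℕ → ℝ) : Prop where
  measurable_init : ∀ i, Measurable (R.x 0 i)
  init_mem : ∀ i ω, R.x 0 i ω ∈ N.X
  /-- the sampled subgradient at time `t` is determined by the samples up to time `t` -/
  measurable_ghat : ∀ t i, Measurable[ℱ (t + 1)] (R.ghat t i)
  ghat_mem : ∀ t i ω, R.ghat t i ω ∈
    subdiff N.O (fun x => N.sample i x (N.u R' t i ω) (R.ξ t i ω)) (N.v R t i ω)
  update : ∀ t i ω, IsProx N.X N.ψ (N.v R t i ω) (-(α t • R.ghat t i ω)) (R.x (t + 1) i ω)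

/-- The sampled subgradients are conditionally unbiased estimates of subgradients of the expected
costs, with conditional second moment of the error at most `ν²`. -/
structure Network.UnbiasedOracle (N : Network E F V V' d) (P : Measure Ω) (ξ : Ω → Fin d → ℝ)
    (ℱ : ℕ → MeasurableSpace Ω) (R : Run Ω E V d) (R' : Run Ω F V' d) (ν : ℝ) : Prop where
  g_mem : ∀ t i, ∀ᵐ ω ∂P, R.g t i ω ∈
    subdiff N.O (fun x => N.cost P ξ i x (N.u R' t i ω)) (N.v R t i ω)
  integrable : ∀ t i, Integrable (R.ghat t i) P
  unbiased : ∀ t i, P[R.ghat t i | ℱ t] =ᵐ[P] R.g t i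
  integrable_sq : ∀ t i, Integrable (fun ω => ‖R.g t i ω - R.ghat t i ω‖ ^ 2) P
  variance_le : ∀ t i,
    ∀ᵐ ω ∂P, (P[fun ω' => ‖R.g t i ω' - R.ghat t i ω'‖ ^ 2 | ℱ t]) ω ≤ ν ^ 2

/-- All samples drawn in the two networks are independent copies of `ξ`. -/
structure IsIIDSample (P : Measure Ω) (ξ : Ω → Fin d → ℝ) (R : Run Ω E V d) (R' : Run Ω F V' d) :
    Prop where
  measurable : ∀ t i, Measurable (R.ξ t i)
  measurable' : ∀ t i, Measurable (R'.ξ t i)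
  indep : iIndepFun (fun k : ℕ × (V ⊕ V') => Sum.elim (R.ξ k.1) (R'.ξ k.1) k.2) P
  identDistrib : ∀ t i, IdentDistrib (R.ξ t i) ξ P P
  identDistrib' : ∀ t i, IdentDistrib (R'.ξ t i) ξ P P

/-- The pseudo regret of network `N` associated with agent `i`, cumulated up to time `T`. (The
infimum over the compact strategy set is a minimum.) -/
noncomputable def pseudoRegret (N : Network E F V V' d) (P : Measure Ω) (ξ : Ω → Fin d → ℝ)
    (R : Run Ω E V d) (R' : Run Ω F V' d) (i : V) (T : ℕ) : ℝ :=
  (∫ ω, ∑ t ∈ Finset.Icc 1 T, N.avgCost P ξ (R.x t i ω) (N.u R' t i ω) ∂P) -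
    sInf ((fun x => ∫ ω, ∑ t ∈ Finset.Icc 1 T, N.avgCost P ξ x (N.u R' t i ω) ∂P) '' N.X)

/-- `Λ = 𝔼[max_i ‖x_i(0)‖]`, which is `max_i ‖x_i(0)‖` for deterministic initial estimates. -/
noncomputable def Lam (P : Measure Ω) (R : Run Ω E V d) : ℝ :=
  ∫ ω, ⨆ i, ‖R.x 0 i ω‖ ∂P

end Game

/-- The step sizes `α(t) = 1 / (η (t + 1))`. -/
noncomputable def stepSize (η : ℝ) (t : ℕ) : ℝ := 1 / (η * ((t : ℝ) + 1))

/-- The contribution `(L + ν) (9 L + ν + 4 L n Γ / (1 - θ))` of a network to the factor of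
`(1 + log T)`. -/
noncomputable def logCoeff (L ν κ : ℝ) (n B : ℕ) : ℝ :=
  (L + ν) * (9 * L + ν + 4 * L * n * Gam κ n / (1 - theta κ n B))

/-- The contribution `n Γ Λ / (1 - θ)` of a network to the constant term. -/
noncomputable def constCoeff (Λ κ : ℝ) (n B : ℕ) : ℝ :=
  n * Gam κ n * Λ / (1 - theta κ n B)

end DSMD

/-! Fix a competitor `x` and let `D` be the Bregman divergence. A mirror step gives `α ⟨ĝ, v - x⟩ ≤
D(x, v) - D(x, x⁺) + α² ‖ĝ‖² / 2` (`IsProx.descent`). Division by `α = 1 / (η (t + 1))` puts the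
weight `η (t + 1)` on both divergences, and strong convexity contributes `-η D(x, v)`, which lowers
the weight of `D(x, v)` to `η t`. Since `D` is convex in its second argument and the mixing matrices
are doubly stochastic, averaging does not increase the sum of the divergences over the agents
(`sum_bregman_mean_le`). So the sum telescopes, the initial divergence has weight `0`, and only `∑
α(t) ‖ĝ‖² / 2` remains: a harmonic sum, hence `log T` (`Network.Follows.sum_descent`). The oracle
error is conditionally centred and is tested against an `ℱ_t`-measurable vector, so its mean
vanishes (`Network.UnbiasedOracle.integral_noise_apply`).

This controls the costs of the agents `j` at `(v_j, u_j)`, whereas the regret evaluates the average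
cost at `(x_i, u_i)`. By the Lipschitz condition the difference is at most a multiple of the
distances of the estimates from their network means (`Network.avgCost_sub_le`). Each network is an
averaging process perturbed by steps of size at most `α ‖ĝ‖`; products of mixing matrices approach
the uniform matrix geometrically (`IsMixing.abs_transition_sub_le`), so the disagreement is a
geometric convolution of the step sizes and again sums to order `log T`. For the opposing network
only this consensus estimate is needed.

The geometric rate comes from the decay of the sum of squares: every gap between consecutive sorted
values is bridged by a communication within `B` steps, and each bridge costs a definite amount of
variance (`IsMixing.sum_sq_le`). -/

namespace DSMD

/-! ### Bregman divergences and the prox-mapping -/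

section Convex

variable {E : Type*} [NormedAddCommGroup E] [NormedSpace ℝ E]

/-- Subgradients of a Lipschitz function on an open set are bounded by the Lipschitz constant. -/
theorem norm_le_of_mem_subdiff {O : Set E} (hO : IsOpen O) {h : E → ℝ} {L : ℝ} (hL : 0 ≤ L)
    (hLip : ∀ x ∈ O, ∀ x' ∈ O, |h x - h x'| ≤ L * ‖x - x'‖) {p : E} (hp : p ∈ O)
    {g : StrongDual ℝ E} (hg : g ∈ subdiff O h p) : ‖g‖ ≤ L := by
  obtain ⟨ε, hε, hball⟩ := Metric.isOpen_iff.1 hO p hp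
  -- Openness of `O` allows every small direction and its opposite, so the one-sided subgradient
  -- inequality bounds `|g z|`.
  have key : ∀ z : E, ‖z‖ < ε → g z ≤ L * ‖z‖ := by
    intro z hz
    have hy : p + z ∈ O := hball (by simpa [Metric.mem_ball, dist_eq_norm] using hz)
    have h1 := hg _ hy
    have h2 := (abs_le.1 (hLip _ hy _ hp)).2
    simp only [add_sub_cancel_left] at h1 h2
    linarith
  refine ContinuousLinearMap.opNorm_le_of_ball hε hL fun z hz => ?_
  have hz' : ‖z‖ < ε := by simpa using hz
  have h1 := key z hz'
  have h2 := key (-z) (by simpa using hz')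
  rw [map_neg, norm_neg] at h2
  rw [Real.norm_eq_abs, abs_le]
  constructor <;> linarith

theorem bregman_self (X : Set E) (ψ : E → ℝ) (x : E) : bregman X ψ x x = 0 := by
  simp [bregman]

/-- The point `p + (x - p) / (n + 1)` of the segment from `p` to `x`. -/
noncomputable def segPoint (x p : E) (n : ℕ) : E := p + ((n : ℝ) + 1)⁻¹ • (x - p)

theorem inv_succ_mem_Icc (n : ℕ) : 0 < ((n : ℝ) + 1)⁻¹ ∧ ((n : ℝ) + 1)⁻¹ ≤ 1 :=
  ⟨by positivity, inv_le_one_of_one_le₀ (by linarith [(Nat.cast_nonneg n : (0 : ℝ) ≤ n)])⟩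

theorem segPoint_mem {X : Set E} (hX : Convex ℝ X) {x p : E} (hx : x ∈ X) (hp : p ∈ X) (n : ℕ) :
    segPoint x p n ∈ X :=
  hX.add_smul_sub_mem hp hx ⟨(inv_succ_mem_Icc n).1.le, (inv_succ_mem_Icc n).2⟩

theorem tendsto_inv_succ : Tendsto (fun n : ℕ => ((n : ℝ) + 1)⁻¹) atTop (𝓝 0) :=
  (tendsto_one_div_add_atTop_nhds_zero_nat (𝕜 := ℝ)).congr fun n => by rw [one_div]

/-- Difference quotients along segments converge to the derivative within a convex set. -/
theorem tendsto_slope_segPoint {X : Set E} (hX : Convex ℝ X) {ψ : E → ℝ}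
    (hψ : DifferentiableOn ℝ ψ X) {x p : E} (hx : x ∈ X) (hp : p ∈ X) :
    Tendsto (fun n : ℕ => ((n : ℝ) + 1) * (ψ (segPoint x p n) - ψ p)) atTop
      (𝓝 (fderivWithin ℝ ψ X p (x - p))) := by
  have h := (hψ p hp).hasFDerivWithinAt
  refine (h.lim (l := atTop) (c := fun n : ℕ => (n : ℝ) + 1)
    (d := fun n : ℕ => ((n : ℝ) + 1)⁻¹ • (x - p)) (v := x - p) ?_ ?_ ?_)
  · simpa using tendsto_inv_succ.smul_const (x - p)
  · exact Eventually.of_forall fun n => segPoint_mem hX hx hp n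
  · refine tendsto_const_nhds.congr fun n => ?_
    rw [smul_smul, mul_inv_cancel₀ (by positivity), one_smul]

/-- Strong convexity at the point dividing the segment from `p` to `x` with ratio `s` bounds the
difference quotient of `ψ` by `ψ x - ψ p - (1 - s) ‖x - p‖² / 2`; let `s → 0`. -/
theorem half_sq_le_bregman {X : Set E} {ψ : E → ℝ} (hψ : DifferentiableOn ℝ ψ X)
    (hsc : StrongConvexOn X 1 ψ) {x p : E} (hx : x ∈ X) (hp : p ∈ X) :
    1 / 2 * ‖x - p‖ ^ 2 ≤ bregman X ψ x p := by
  have h1 := tendsto_slope_segPoint hsc.1 hψ hx hp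
  have h2 : Tendsto (fun n : ℕ => ψ x - ψ p - (1 - ((n : ℝ) + 1)⁻¹) * (1 / 2 * ‖x - p‖ ^ 2)) atTop
      (𝓝 (ψ x - ψ p - (1 - 0) * (1 / 2 * ‖x - p‖ ^ 2))) :=
    tendsto_const_nhds.sub ((tendsto_const_nhds.sub tendsto_inv_succ).mul_const _)
  have h3 := le_of_tendsto_of_tendsto' h1 h2 fun n => by
    obtain ⟨hs0, hs1⟩ := inv_succ_mem_Icc n
    have hn : (0 : ℝ) < (n : ℝ) + 1 := by positivity
    set s := ((n : ℝ) + 1)⁻¹ with hs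
    have := hsc.2 hx hp hs0.le (sub_nonneg.2 hs1) (by ring)
    have he : s • x + (1 - s) • p = segPoint x p n := by
      simp only [segPoint, ← hs]; module
    rw [he] at this
    simp only [smul_eq_mul] at this
    have hns : ((n : ℝ) + 1) * s = 1 := mul_inv_cancel₀ hn.ne'
    calc ((n : ℝ) + 1) * (ψ (segPoint x p n) - ψ p)
        ≤ ((n : ℝ) + 1) * (s * (ψ x - ψ p - (1 - s) * (1 / 2 * ‖x - p‖ ^ 2))) := by
          apply mul_le_mul_of_nonneg_left _ hn.le
          linarith
      _ = _ := by rw [← mul_assoc, hns, one_mul]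
  unfold bregman
  linarith

theorem bregman_nonneg {X : Set E} {ψ : E → ℝ} (hψ : DifferentiableOn ℝ ψ X)
    (hsc : StrongConvexOn X 1 ψ) {x p : E} (hx : x ∈ X) (hp : p ∈ X) : 0 ≤ bregman X ψ x p :=
  le_trans (by positivity) (half_sq_le_bregman hψ hsc hx hp)

/-- The three-point inequality of the prox-mapping. -/
theorem IsProx.three_point {X : Set E} (hX : Convex ℝ X) {ψ : E → ℝ} (hψ : DifferentiableOn ℝ ψ X)
    {p : E} {y : StrongDual ℝ E} {q : E} (hq : IsProx X ψ p y q) {x : E} (hx : x ∈ X) :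
    bregman X ψ q p + bregman X ψ x q + y (x - q) ≤ bregman X ψ x p := by
  have h1 := tendsto_slope_segPoint hX hψ hx hq.1
  -- First-order optimality of `q`, in the limit of comparisons with points of the segment from `q`
  -- to `x`. Only directions pointing into `X` occur, so `X` may have empty interior.
  have h3 : y (x - q) + fderivWithin ℝ ψ X p (x - q) ≤ fderivWithin ℝ ψ X q (x - q) := by
    refine ge_of_tendsto' h1 fun n => ?_
    have hn : (0 : ℝ) < (n : ℝ) + 1 := by positivity
    have hmin := isMinOn_iff.1 hq.2 _ (segPoint_mem hX hx hq.1 n)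
    simp only [bregman, map_sub] at hmin
    have e1 : y (segPoint x q n) = y q + ((n : ℝ) + 1)⁻¹ * y (x - q) := by
      simp [segPoint, map_add, map_smul]
    have e2 : fderivWithin ℝ ψ X p (segPoint x q n) =
        fderivWithin ℝ ψ X p q + ((n : ℝ) + 1)⁻¹ * fderivWithin ℝ ψ X p (x - q) := by
      simp [segPoint, map_add, map_smul]
    rw [e1, e2] at hmin
    have : ((n : ℝ) + 1)⁻¹ * (y (x - q) + fderivWithin ℝ ψ X p (x - q)) ≤
      ψ (segPoint x q n) - ψ q := by linarith
    rwa [inv_mul_le_iff₀ hn] at this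
  simp only [bregman, map_sub] at h3 ⊢
  linarith

/-- The three-point inequality at `x = p`, with the quadratic lower bound on both `D(q, p)` and
`D(p, q)`, gives `‖q - p‖² ≤ ‖y‖ ‖q - p‖`. -/
theorem IsProx.norm_sub_le {X : Set E} {ψ : E → ℝ} (hψ : DifferentiableOn ℝ ψ X)
    (hsc : StrongConvexOn X 1 ψ) {p : E} (hp : p ∈ X) {y : StrongDual ℝ E} {q : E}
    (hq : IsProx X ψ p y q) : ‖q - p‖ ≤ ‖y‖ := by
  have h1 := hq.three_point hsc.1 hψ hp
  rw [bregman_self] at h1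
  have h2 := half_sq_le_bregman hψ hsc hq.1 hp
  have h3 := half_sq_le_bregman hψ hsc hp hq.1
  have h4 := y.le_opNorm (p - q)
  have h5 := (abs_le.1 (Real.norm_eq_abs _ ▸ h4)).1
  rw [norm_sub_rev p q] at h3 h5
  by_contra! hlt
  have hpos : 0 < ‖q - p‖ := lt_of_le_of_lt (norm_nonneg _) hlt
  nlinarith

/-- One step of mirror descent. -/
theorem IsProx.descent {X : Set E} {ψ : E → ℝ} (hψ : DifferentiableOn ℝ ψ X)
    (hsc : StrongConvexOn X 1 ψ) {p : E} (hp : p ∈ X) {g : StrongDual ℝ E} {α : ℝ} (hα : 0 ≤ α)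
    {q : E} (hq : IsProx X ψ p (-(α • g)) q) {x : E} (hx : x ∈ X) :
    α * g (p - x) ≤ bregman X ψ x p - bregman X ψ x q + α ^ 2 * ‖g‖ ^ 2 / 2 := by
  have h1 := hq.three_point hsc.1 hψ hx
  have h2 := half_sq_le_bregman hψ hsc hq.1 hp
  have h4 := (abs_le.1 (Real.norm_eq_abs _ ▸ g.le_opNorm (p - q))).2
  rw [norm_sub_rev p q] at h4
  simp only [neg_apply, smul_apply, smul_eq_mul,
    map_sub] at h1 h4 ⊢
  have h5 := mul_le_mul_of_nonneg_left h4 hα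
  -- Young's inequality: `α ‖g‖ ‖q - p‖ ≤ α² ‖g‖² / 2 + ‖q - p‖² / 2`, and the last term is absorbed
  -- by `D(q, p)`.
  nlinarith [sq_nonneg (α * ‖g‖ - ‖q - p‖)]

/-- Minimizers of the prox-problem have quadratic growth. -/
theorem IsProx.growth {X : Set E} {ψ : E → ℝ} (hψ : DifferentiableOn ℝ ψ X)
    (hsc : StrongConvexOn X 1 ψ) {p : E} {y : StrongDual ℝ E} {q : E}
    (hq : IsProx X ψ p y q) {x : E} (hx : x ∈ X) :
    1 / 2 * ‖x - q‖ ^ 2 ≤ (y (p - x) + bregman X ψ x p) - (y (p - q) + bregman X ψ q p) := by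
  have h1 := hq.three_point hsc.1 hψ hx
  have h2 := half_sq_le_bregman hψ hsc hx hq.1
  simp only [map_sub] at h1 ⊢
  linarith

/-- A function with a subgradient at `p` that is strongly convex and Lipschitz confines the
strategy set to a ball around `p`. -/
theorem norm_sub_le_of_stronglyConvexWrt {O X : Set E} {ψ : E → ℝ} (hψ : DifferentiableOn ℝ ψ X)
    (hsc : StrongConvexOn X 1 ψ) {η : ℝ} (hη : 0 < η) {f : E → ℝ}
    (hf : StronglyConvexWrt O X ψ η f) {L : ℝ}
    (hLip : ∀ x ∈ X, ∀ x' ∈ X, |f x - f x'| ≤ L * ‖x - x'‖) {p : E} (hp : p ∈ X)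
    {g : StrongDual ℝ E} (hg : g ∈ subdiff O f p) (hgL : ‖g‖ ≤ L) {x : E} (hx : x ∈ X) :
    ‖x - p‖ ≤ 4 * L / η := by
  have h1 := hf x hx p hp g hg
  have h2 := half_sq_le_bregman hψ hsc hx hp
  have h3 := (abs_le.1 (hLip x hx p hp)).2
  have h4 := (abs_le.1 (Real.norm_eq_abs _ ▸ g.le_opNorm (x - p))).1
  have h5 := mul_le_mul_of_nonneg_right hgL (norm_nonneg (x - p))
  have h6 := mul_le_mul_of_nonneg_left h2 hη.le
  rw [le_div_iff₀ hη]
  -- With `r = ‖x - p‖`, the estimates above combine to `η r² / 2 ≤ 2 L r`.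
  by_contra! hlt
  have hL : 0 ≤ L := (norm_nonneg _).trans hgL
  have hpos : 0 < ‖x - p‖ := by
    by_contra! h0
    have : ‖x - p‖ = 0 := le_antisymm h0 (norm_nonneg _)
    rw [this] at hlt
    linarith
  nlinarith

end Convex

/-! ### Measurability of the iterates -/

section Measurability

variable {Ω : Type*} {m : MeasurableSpace Ω}
  {E : Type*} [NormedAddCommGroup E] [NormedSpace ℝ E] [MeasurableSpace E] [BorelSpace E]

theorem measurable_comp_of_continuousOn {E G : Type*} [TopologicalSpace E] [MeasurableSpace E]
    [OpensMeasurableSpace E] [TopologicalSpace G] [MeasurableSpace G] [BorelSpace G]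
    {f : E → G} {s : Set E} (hf : ContinuousOn f s) {u : Ω → E}
    (hu : Measurable u) (hus : ∀ ω, u ω ∈ s) : Measurable fun ω => f (u ω) :=
  (continuousOn_iff_continuous_domRestrict.1 hf).measurable.comp (hu.subtype_mk (h := hus))

/-- The derivative is a pointwise limit of difference quotients along segments, and these are
measurable because `ψ` is continuous on `X`; no regularity of the derivative in the base point is
needed. -/
theorem measurable_fderivWithin_apply [FiniteDimensional ℝ E] {X : Set E} (hX : Convex ℝ X)
    {ψ : E → ℝ} (hψ : DifferentiableOn ℝ ψ X) {x : E} (hx : x ∈ X) {p : Ω → E} (hp : Measurable p)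
    (hpX : ∀ ω, p ω ∈ X) : Measurable fun ω => fderivWithin ℝ ψ X (p ω) (x - p ω) := by
  have := FiniteDimensional.proper ℝ E
  have hm : ∀ n : ℕ, Measurable fun ω => segPoint x (p ω) n := fun n =>
    hp.add ((measurable_const.sub hp).const_smul _)
  refine measurable_of_tendsto_metrizable
    (f := fun (n : ℕ) ω => ((n : ℝ) + 1) * (ψ (segPoint x (p ω) n) - ψ (p ω))) (fun n => ?_)
    (tendsto_pi_nhds.2 fun ω => tendsto_slope_segPoint hX hψ hx (hpX ω))
  exact ((measurable_comp_of_continuousOn hψ.continuousOn (hm n)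
    fun ω => segPoint_mem hX hx (hpX ω) n).sub
      (measurable_comp_of_continuousOn hψ.continuousOn hp hpX)).const_mul _

theorem measurable_bregman [FiniteDimensional ℝ E] {X : Set E} (hX : Convex ℝ X)
    {ψ : E → ℝ} (hψ : DifferentiableOn ℝ ψ X) {x : E} (hx : x ∈ X) {p : Ω → E} (hp : Measurable p)
    (hpX : ∀ ω, p ω ∈ X) : Measurable fun ω => bregman X ψ x (p ω) :=
  (measurable_const.sub (measurable_comp_of_continuousOn hψ.continuousOn hp hpX)).sub
    (measurable_fderivWithin_apply hX hψ hx hp hpX)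

theorem measurable_clm_apply [FiniteDimensional ℝ E] {g : Ω → StrongDual ℝ E} {w : Ω → E}
    (hg : Measurable g) (hw : Measurable w) : Measurable fun ω => g ω (w ω) := by
  have := FiniteDimensional.proper ℝ E
  exact (isBoundedBilinearMap_apply (𝕜 := ℝ) (E := E) (F := ℝ)).continuous.measurable.comp
    (hg.prodMk hw)

/-- Measurability of a minimizer with quadratic growth. -/
theorem measurable_argmin {E : Type*} [NormedAddCommGroup E] [MeasurableSpace E] [BorelSpace E]
    [SecondCountableTopology E] {X : Set E} {F : Ω → E → ℝ}
    (hmeas : ∀ x ∈ X, Measurable fun ω => F ω x) (hcont : ∀ ω, ContinuousOn (F ω) X) {q : Ω → E}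
    (hq : ∀ ω, q ω ∈ X)
    (hgrowth : ∀ ω, ∀ x ∈ X, 1 / 2 * ‖x - q ω‖ ^ 2 ≤ F ω x - F ω (q ω)) : Measurable q := by
  classical
  rcases isEmpty_or_nonempty Ω with hΩ | ⟨⟨ω₀⟩⟩
  · exact measurable_of_empty _
  have : Nonempty X := ⟨⟨q ω₀, hq ω₀⟩⟩
  let s : ℕ → X := TopologicalSpace.denseSeq X
  have hs : DenseRange s := TopologicalSpace.denseRange_denseSeq X
  -- near-minimality against a dense sequence implies near-minimality
  have hlim : ∀ ω (c : ℝ), (∀ l, c ≤ F ω (s l)) → c ≤ F ω (q ω) := by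
    intro ω c hc
    have hcl : IsClosed {x : X | c ≤ F ω x} :=
      isClosed_le continuous_const (continuousOn_iff_continuous_domRestrict.1 (hcont ω))
    have : ∀ x : X, c ≤ F ω x := fun x => hs.induction_on x hcl hc
    exact this ⟨q ω, hq ω⟩
  -- `p n k ω`: the `k`-th dense point is minimal up to `1 / (n + 1)` among all dense points. This
  -- involves countably many comparisons, so the first such `k` is measurable in `ω`; quadratic
  -- growth forces the selected points to converge to `q ω`.
  let p : ℕ → ℕ → Ω → Prop := fun n k ω => ∀ l, F ω (s k) ≤ F ω (s l) + ((n : ℝ) + 1)⁻¹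
  have hex : ∀ n ω, ∃ k, p n k ω := by
    intro n ω
    have hpos := (inv_succ_mem_Icc n).1
    have hop : IsOpen {x : X | F ω x < F ω (q ω) + ((n : ℝ) + 1)⁻¹} :=
      isOpen_lt (continuousOn_iff_continuous_domRestrict.1 (hcont ω)) continuous_const
    obtain ⟨k, hk⟩ := hs.exists_mem_open hop ⟨⟨q ω, hq ω⟩, by
      simpa using lt_add_of_pos_right (F ω (q ω)) hpos⟩
    refine ⟨k, fun l => ?_⟩
    have h1 := hgrowth ω _ (s l).2
    have h2 : 0 ≤ 1 / 2 * ‖(s l : E) - q ω‖ ^ 2 := by positivity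
    have h3 : F ω (s k) < F ω (q ω) + ((n : ℝ) + 1)⁻¹ := hk
    linarith
  have hmp : ∀ n k, MeasurableSet {ω | p n k ω} := by
    intro n k
    simp only [p, Set.ofPred_forall]
    exact MeasurableSet.iInter fun l => measurableSet_le (hmeas _ (s k).2)
      ((hmeas _ (s l).2).add_const _)
  have hqn : ∀ n, Measurable fun ω => ((s (Nat.find (hex n ω)) : X) : E) := fun n =>
    (measurable_from_nat (f := fun k => ((s k : X) : E))).comp (measurable_find (hex n) (hmp n))
  refine measurable_of_tendsto_metrizable hqn (tendsto_pi_nhds.2 fun ω => ?_)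
  have hbound : ∀ n : ℕ, ‖((s (Nat.find (hex n ω)) : X) : E) - q ω‖ ^ 2 ≤
      2 * ((n : ℝ) + 1)⁻¹ := by
    intro n
    have h1 := hgrowth ω _ (s (Nat.find (hex n ω))).2
    have h2 := hlim ω (F ω (s (Nat.find (hex n ω))) - ((n : ℝ) + 1)⁻¹) fun l => by
      have := Nat.find_spec (hex n ω) l
      linarith
    linarith
  have h0 : Tendsto (fun n : ℕ => ‖((s (Nat.find (hex n ω)) : X) : E) - q ω‖ ^ 2) atTop (𝓝 0) :=
    squeeze_zero (fun _ => by positivity) hbound (by simpa using tendsto_inv_succ.const_mul 2)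
  rw [tendsto_iff_norm_sub_tendsto_zero]
  simpa using h0.sqrt

/-- The iterates are given only as minimizers, so their measurability must be derived; it follows
from the quadratic growth of the prox objective. -/
theorem measurable_prox [FiniteDimensional ℝ E] {X : Set E}
    {ψ : E → ℝ} (hψ : DifferentiableOn ℝ ψ X) (hsc : StrongConvexOn X 1 ψ) {p : Ω → E}
    (hp : Measurable p) (hpX : ∀ ω, p ω ∈ X) {y : Ω → StrongDual ℝ E} (hy : Measurable y)
    {q : Ω → E} (hq : ∀ ω, IsProx X ψ (p ω) (y ω) (q ω)) : Measurable q := by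
  have := FiniteDimensional.proper ℝ E
  refine measurable_argmin (X := X) (F := fun ω x => y ω (p ω - x) + bregman X ψ x (p ω))
    (fun x hx => ?_) (fun ω => ?_) (fun ω => (hq ω).1) fun ω x hx => (hq ω).growth hψ hsc hx
  · exact (measurable_clm_apply hy (hp.sub_const x)).add (measurable_bregman hsc.1 hψ hx hp hpX)
  · unfold bregman
    have := hψ.continuousOn
    fun_prop

end Measurability

end DSMD

namespace DSMD

/-! ### Contraction of the sum of squares under averaging -/

section Consensus

variable {V : Type*} [Fintype V] {κ : ℝ} {B : ℕ} {edge : ℕ → V → V → Prop}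
  {W : ℕ → Matrix V V ℝ}

theorem IsMixing.nonneg (hκ : 0 < κ) (h : IsMixing κ B edge W) (t : ℕ) (i j : V) : 0 ≤ W t i j := by
  by_cases he : edge t j i
  · exact hκ.le.trans (h.weight_ge t i j he)
  · exact (h.weight_eq_zero t i j he).ge

theorem IsMixing.shift (h : IsMixing κ B edge W) (s : ℕ) :
    IsMixing κ B (fun t => edge (s + t)) (fun t => W (s + t)) where
  weight_ge t := h.weight_ge _
  weight_eq_zero t := h.weight_eq_zero _
  row_sum t := h.row_sum _
  col_sum t := h.col_sum _
  self_loop t := h.self_loop _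
  one_le := h.one_le
  strongly_connected k i j := by
    refine Relation.ReflTransGen.mono ?_ i j (h.strongly_connected (s + k) i j)
    rintro a b ⟨t, h1, h2, h3⟩
    exact ⟨t - s, by omega, by omega, by rwa [Nat.add_sub_cancel' (by omega)]⟩

/-- One averaging step decreases the sum of squares by the sum of the row variances. -/
theorem sum_sq_mulVec {M : Matrix V V ℝ} (hrow : ∀ i, ∑ j, M i j = 1) (hcol : ∀ j, ∑ i, M i j = 1)
    (z : V → ℝ) :
    ∑ k, (M.mulVec z k) ^ 2 + ∑ k, ∑ i, M k i * (z i - M.mulVec z k) ^ 2 = ∑ i, z i ^ 2 := by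
  have h1 : ∀ k, ∑ i, M k i * (z i - M.mulVec z k) ^ 2 =
      ∑ i, M k i * z i ^ 2 - (M.mulVec z k) ^ 2 := by
    intro k
    have hmv : ∑ i, M k i * z i = M.mulVec z k := rfl
    calc ∑ i, M k i * (z i - M.mulVec z k) ^ 2
        = ∑ i, M k i * z i ^ 2 - 2 * M.mulVec z k * ∑ i, M k i * z i +
            (M.mulVec z k) ^ 2 * ∑ i, M k i := by
          rw [Finset.mul_sum, Finset.mul_sum, ← Finset.sum_sub_distrib, ← Finset.sum_add_distrib]
          exact Finset.sum_congr rfl fun i _ => by ring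
      _ = _ := by rw [hmv, hrow]; ring
  simp only [h1, Finset.sum_sub_distrib]
  rw [Finset.sum_comm]
  simp only [← Finset.sum_mul, hcol, one_mul]
  ring

/-- The variance of a weighted average in terms of two of its entries. -/
theorem half_mul_sq_sub_le_sum {w z : V → ℝ} (hw : ∀ i, 0 ≤ w i) (hκ : 0 ≤ κ) {i j : V}
    (hi : κ ≤ w i) (hj : κ ≤ w j) (c : ℝ) :
    κ / 2 * (z i - z j) ^ 2 ≤ ∑ l, w l * (z l - c) ^ 2 := by
  classical
  by_cases hij : i = j
  · subst hij
    simpa using Finset.sum_nonneg fun l _ => mul_nonneg (hw l) (sq_nonneg _)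
  have h1 : ∑ l ∈ {i, j}, w l * (z l - c) ^ 2 ≤ ∑ l, w l * (z l - c) ^ 2 :=
    Finset.sum_le_sum_of_subset_of_nonneg (Finset.subset_univ _) fun l _ _ =>
      mul_nonneg (hw l) (sq_nonneg _)
  rw [Finset.sum_pair hij] at h1
  have h2 := mul_le_mul_of_nonneg_right hi (sq_nonneg (z i - c))
  have h3 := mul_le_mul_of_nonneg_right hj (sq_nonneg (z j - c))
  -- `a² + b² = (a - b)² / 2 + (a + b)² / 2` with `a = z i - c`, `b = z j - c`.
  nlinarith [mul_nonneg hκ (sq_nonneg (z i + z j - 2 * c))]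

/-- A convex combination of numbers `≤ c` is `≤ c`. -/
theorem mulVec_le_of_le {M : Matrix V V ℝ} {z : V → ℝ} {i : V} {c : ℝ} (h0 : ∀ j, 0 ≤ M i j)
    (hrow : ∑ j, M i j = 1) (hz : ∀ j, M i j ≠ 0 → z j ≤ c) : M.mulVec z i ≤ c := by
  calc M.mulVec z i = ∑ j, M i j * z j := rfl
    _ ≤ ∑ j, M i j * c := Finset.sum_le_sum fun j _ => by
        by_cases h : M i j = 0
        · simp [h]
        · exact mul_le_mul_of_nonneg_left (hz j h) (h0 j)
    _ = c := by rw [← Finset.sum_mul, hrow, one_mul]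

theorem le_mulVec_of_le {M : Matrix V V ℝ} {z : V → ℝ} {i : V} {c : ℝ} (h0 : ∀ j, 0 ≤ M i j)
    (hrow : ∑ j, M i j = 1) (hz : ∀ j, M i j ≠ 0 → c ≤ z j) : c ≤ M.mulVec z i := by
  have := mulVec_le_of_le (z := -z) (c := -c) h0 hrow fun j hj => neg_le_neg (hz j hj)
  rw [Matrix.mulVec_neg] at this
  exact neg_le_neg_iff.1 this

theorem exists_step_of_reflTransGen {V : Type*} {r : V → V → Prop} {S : Set V} {i j : V}
    (h : Relation.ReflTransGen r i j) (hi : i ∈ S) (hj : j ∉ S) : ∃ a b, r a b ∧ a ∈ S ∧ b ∉ S := by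
  induction h with
  | refl => exact absurd hi hj
  | @tail b c _ hbc ih =>
    by_cases hb : b ∈ S
    · exact ⟨b, c, hbc, hb, hj⟩
    · exact ih hb

/-- Values separated by a cut stay separated until the first communication across the cut, which
happens within `B` steps. -/
theorem IsMixing.exists_cut_bridge (hκ : 0 < κ) (h : IsMixing κ B edge W) {z : ℕ → V → ℝ}
    (hz : ∀ t, z (t + 1) = (W t).mulVec (z t)) {S : Set V} {i₀ j₀ : V} (hi₀ : i₀ ∈ S) (hj₀ : j₀ ∉ S)
    {lo hi : ℝ} (hhi : ∀ i ∈ S, hi ≤ z 0 i) (hlo : ∀ i ∉ S, z 0 i ≤ lo) :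
    ∃ t < B, ∃ k i j, edge t i k ∧ edge t j k ∧ z t i ≤ lo ∧ hi ≤ z t j := by
  classical
  -- `C t`: some edge crosses the cut at time `t`, in either direction. Until the first such time
  -- the two sides average separately, so the bounds `hi` and `lo` persist.
  let C : ℕ → Prop := fun t => ∃ a b, edge t a b ∧ ¬ (a ∈ S ↔ b ∈ S)
  obtain ⟨a, b, ⟨t₁, -, ht₁, hab⟩, ha, hb⟩ :=
    exists_step_of_reflTransGen (h.strongly_connected 0 i₀ j₀) hi₀ hj₀
  have hex : ∃ t, C t := ⟨t₁, a, b, hab, by tauto⟩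
  have hsep : ∀ t ≤ Nat.find hex, (∀ i ∈ S, hi ≤ z t i) ∧ ∀ i ∉ S, z t i ≤ lo := by
    intro t
    induction t with
    | zero => exact fun _ => ⟨hhi, hlo⟩
    | succ t ih =>
      intro ht
      obtain ⟨ih1, ih2⟩ := ih (by omega)
      have hC : ¬ C t := Nat.find_min hex (by omega)
      have hC' : ∀ i j, W t i j ≠ 0 → (j ∈ S ↔ i ∈ S) := by
        intro i j hij
        by_contra hne
        exact hC ⟨j, i, by_contra fun he => hij (h.weight_eq_zero t i j he), hne⟩
      rw [hz]
      exact ⟨fun i hi => le_mulVec_of_le (h.nonneg hκ t i) (h.row_sum t i)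
          fun j hj => ih1 j ((hC' i j hj).2 hi),
        fun i hi => mulVec_le_of_le (h.nonneg hκ t i) (h.row_sum t i)
          fun j hj => ih2 j (mt (hC' i j hj).1 hi)⟩
  obtain ⟨h1, h2⟩ := hsep _ le_rfl
  have hlt : Nat.find hex < B := by
    have : Nat.find hex ≤ t₁ := Nat.find_min' hex ⟨a, b, hab, by tauto⟩
    omega
  obtain ⟨c, e, hce, hne⟩ := Nat.find_spec hex
  -- The receiver `e` of the crossing edge hears one side from the sender `c` and the other from
  -- itself, through its self-loop.
  by_cases hc : c ∈ S
  · exact ⟨_, hlt, e, e, c, h.self_loop _ _, hce, h2 e (by tauto), h1 c hc⟩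
  · exact ⟨_, hlt, e, c, e, hce, h.self_loop _ _, h2 c hc, h1 e (by tauto)⟩

/-- The gaps indexed by `D` are non-overlapping subintervals of `[lo, hi]`, and a sum of squares of
nonnegative numbers is at most the square of their sum. -/
theorem sum_sq_gaps_le {y : ℕ → ℝ} (hy : Monotone y) {D : Finset ℕ} (hD : D.Nonempty) {lo hi : ℝ}
    (hlo : lo ≤ y (D.min' hD)) (hhi : y (D.max' hD + 1) ≤ hi) :
    ∑ d ∈ D, (y (d + 1) - y d) ^ 2 ≤ (hi - lo) ^ 2 := by
  have h0 : ∀ d, 0 ≤ y (d + 1) - y d := fun d => sub_nonneg.2 (hy (Nat.le_succ d))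
  have h1 : ∑ d ∈ D, (y (d + 1) - y d) ≤ hi - lo := by
    calc ∑ d ∈ D, (y (d + 1) - y d)
        ≤ ∑ d ∈ Finset.Ico (D.min' hD) (D.max' hD + 1), (y (d + 1) - y d) :=
          Finset.sum_le_sum_of_subset_of_nonneg (fun d hd => Finset.mem_Ico.2
            ⟨D.min'_le d hd, Nat.lt_succ_of_le (D.le_max' d hd)⟩) fun d _ _ => h0 d
      _ = y (D.max' hD + 1) - y (D.min' hD) := by
          have hle : D.min' hD ≤ D.max' hD + 1 := (D.min'_le_max' hD).trans (Nat.le_succ _)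
          rw [Finset.sum_Ico_eq_sub _ hle, Finset.sum_range_sub, Finset.sum_range_sub]
          ring
      _ ≤ hi - lo := by linarith
  calc ∑ d ∈ D, (y (d + 1) - y d) ^ 2 ≤ (∑ d ∈ D, (y (d + 1) - y d)) ^ 2 :=
        Finset.sum_sq_le_sq_sum_of_nonneg fun d _ => h0 d
    _ ≤ (hi - lo) ^ 2 := pow_le_pow_left₀ (Finset.sum_nonneg fun d _ => h0 d) h1 2

/-- Sorts the values. The sequence is continued by its last value beyond index `n - 1`, so that
monotonicity holds on all of `ℕ`. -/
theorem exists_monotone_enumeration [Nonempty V] {n : ℕ} (hn : n = Fintype.card V) (z : V → ℝ) :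
    ∃ (e : Fin n ≃ V) (y : ℕ → ℝ), Monotone y ∧ ∀ d, y d.1 = z (e d) := by
  let e₀ : Fin n ≃ V := (Fintype.equivFinOfCardEq hn.symm).symm
  let e := (Tuple.sort (z ∘ e₀)).trans e₀
  have hmono : Monotone (z ∘ e) := Tuple.monotone_sort (z ∘ e₀)
  have hpos : 0 < n := hn ▸ Fintype.card_pos
  refine ⟨e, fun d => z (e ⟨min d (n - 1), by omega⟩), fun a b hab => ?_, fun d => ?_⟩
  · exact hmono (Fin.mk_le_mk.2 (by omega))
  · exact congrArg (fun k => z (e k))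
      (Fin.ext (show min d.1 (n - 1) = d.1 by have := d.2; omega))

/-- Over `B` steps, a sequence of averages with mean zero contracts. -/
theorem IsMixing.sum_sq_le (hκ : 0 < κ) (h : IsMixing κ B edge W) [Nonempty V] {z : ℕ → V → ℝ}
    (hz : ∀ t, z (t + 1) = (W t).mulVec (z t)) (h0 : ∑ i, z 0 i = 0) :
    ∑ i, z B i ^ 2 ≤ (1 - κ / (2 * (Fintype.card V : ℝ) ^ 2)) * ∑ i, z 0 i ^ 2 := by
  classical
  obtain ⟨n, hn⟩ : ∃ n, n = Fintype.card V := ⟨_, rfl⟩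
  obtain ⟨e, y, hy, hye⟩ := exists_monotone_enumeration hn (z 0)
  rw [← hn]
  have hpos : 0 < n := hn ▸ Fintype.card_pos
  let loss : ℕ → V → ℝ := fun t k => ∑ i, W t k i * (z t i - z (t + 1) k) ^ 2
  have hloss0 : ∀ t k, 0 ≤ loss t k := fun t k =>
    Finset.sum_nonneg fun i _ => mul_nonneg (h.nonneg hκ t k i) (sq_nonneg _)
  -- Energy balance: the sum of squares decreases exactly by the accumulated row variances `loss`.
  have htotal : ∀ T, ∑ i, z T i ^ 2 + ∑ t ∈ Finset.range T, ∑ k, loss t k = ∑ i, z 0 i ^ 2 := by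
    intro T
    induction T with
    | zero => simp
    | succ T ih =>
      rw [Finset.sum_range_succ, ← ih, ← sum_sq_mulVec (h.row_sum T) (h.col_sum T) (z T)]
      simp only [loss, hz]
      ring
  -- Assigns to each gap `d` of the sorted initial values a time and an agent at which values from
  -- below and above the gap are averaged. The value for `d ≥ n - 1` is a dummy.
  have hbridge : ∀ d, ∃ p : ℕ × V, d < n - 1 → p.1 < B ∧ ∃ i j, edge p.1 i p.2 ∧ edge p.1 j p.2 ∧
      z p.1 i ≤ y d ∧ y (d + 1) ≤ z p.1 j := by
    intro d
    by_cases hd : d < n - 1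
    · obtain ⟨t, htB, k, i, j, h1, h2, h3, h4⟩ := h.exists_cut_bridge hκ hz
        (S := {v | d + 1 ≤ (e.symm v).1}) (i₀ := e ⟨d + 1, by omega⟩) (j₀ := e ⟨d, by omega⟩)
        (lo := y d) (hi := y (d + 1)) (by simp) (by simp)
        (fun i hi => by
          have := hye (e.symm i)
          rw [e.apply_symm_apply] at this
          rw [← this]
          exact hy hi)
        (fun i hi => by
          have := hye (e.symm i)
          rw [e.apply_symm_apply] at this
          rw [← this]
          simp only [Set.mem_ofPred_eq] at hi
          exact hy (by omega))
      exact ⟨(t, k), fun _ => ⟨htB, i, j, h1, h2, h3, h4⟩⟩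
    · exact ⟨(0, e ⟨0, hpos⟩), fun h => absurd h hd⟩
  choose p hp using hbridge
  have hgaps : κ / 2 * ∑ d ∈ Finset.range (n - 1), (y (d + 1) - y d) ^ 2 ≤
      ∑ t ∈ Finset.range B, ∑ k, loss t k := by
    rw [← Finset.sum_product', ← Finset.sum_fiberwise_of_maps_to
      (s := Finset.range (n - 1)) (t := Finset.range B ×ˢ Finset.univ) (g := p) (fun d hd =>
        Finset.mem_product.2 ⟨Finset.mem_range.2 (hp d (Finset.mem_range.1 hd)).1,
          Finset.mem_univ _⟩), Finset.mul_sum]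
    refine Finset.sum_le_sum fun q hq => ?_
    -- `D` collects the gaps bridged by the same agent at the same time. A neighbour below the
    -- lowest gap and one above the highest span all of them, so a single variance term pays for the
    -- whole group.
    set D := (Finset.range (n - 1)).filter (fun d => p d = q) with hDdef
    rcases D.eq_empty_or_nonempty with hD | hD
    · rw [hD]
      simpa using hloss0 q.1 q.2
    have hmem : ∀ d ∈ D, d < n - 1 ∧ p d = q := fun d hd => by
      simpa [hDdef] using hd
    obtain ⟨ha, hpa⟩ := hmem _ (D.min'_mem hD)
    obtain ⟨hb, hpb⟩ := hmem _ (D.max'_mem hD)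
    obtain ⟨-, i, -, hi, -, hzi, -⟩ := hp _ ha
    obtain ⟨-, -, j, -, hj, -, hzj⟩ := hp _ hb
    rw [hpa] at hi hzi
    rw [hpb] at hj hzj
    calc κ / 2 * ∑ d ∈ D, (y (d + 1) - y d) ^ 2
        ≤ κ / 2 * (z q.1 j - z q.1 i) ^ 2 :=
          mul_le_mul_of_nonneg_left (sum_sq_gaps_le hy hD hzi hzj) (by positivity)
      _ ≤ loss q.1 q.2 := half_mul_sq_sub_le_sum (h.nonneg hκ q.1 q.2) hκ.le
          (h.weight_ge _ _ _ hj) (h.weight_ge _ _ _ hi) _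
  -- Mean zero makes `∑ z²` at most the sum of squares about the minimum `y 0`, hence at most `n`
  -- times the squared range; Cauchy–Schwarz over the `n - 1` gaps supplies the other factor `n`.
  have hspread : ∑ i, z 0 i ^ 2 ≤
      (n : ℝ) ^ 2 * ∑ d ∈ Finset.range (n - 1), (y (d + 1) - y d) ^ 2 := by
    have h1 : ∑ i, (z 0 i - y 0) ^ 2 = ∑ i, z 0 i ^ 2 + n * y 0 ^ 2 := by
      calc ∑ i, (z 0 i - y 0) ^ 2 = ∑ i, (z 0 i ^ 2 - 2 * y 0 * z 0 i + y 0 ^ 2) :=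
            Finset.sum_congr rfl fun i _ => by ring
        _ = _ := by
            rw [Finset.sum_add_distrib, Finset.sum_sub_distrib, ← Finset.mul_sum, h0]
            simp [hn]
    have h2 : ∀ i, (z 0 i - y 0) ^ 2 ≤ (y (n - 1) - y 0) ^ 2 := by
      intro i
      have h3 := hye (e.symm i)
      rw [e.apply_symm_apply] at h3
      rw [← h3]
      have h4 : y 0 ≤ y (e.symm i).1 := hy (Nat.zero_le _)
      have h5 : y (e.symm i).1 ≤ y (n - 1) := hy (by have := (e.symm i).2; omega)
      exact pow_le_pow_left₀ (by linarith) (by linarith) 2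
    have h3 : (y (n - 1) - y 0) ^ 2 ≤
        n * ∑ d ∈ Finset.range (n - 1), (y (d + 1) - y d) ^ 2 := by
      rw [← Finset.sum_range_sub]
      refine (sq_sum_le_card_mul_sum_sq).trans ?_
      rw [Finset.card_range]
      exact mul_le_mul_of_nonneg_right (by exact_mod_cast Nat.sub_le n 1)
        (Finset.sum_nonneg fun _ _ => sq_nonneg _)
    have h4 : ∑ i, (z 0 i - y 0) ^ 2 ≤ n * (y (n - 1) - y 0) ^ 2 := by
      simpa [hn] using Finset.sum_le_sum fun i (_ : i ∈ Finset.univ) => h2 i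
    have h5 : (n : ℝ) * (y (n - 1) - y 0) ^ 2 ≤
        n * (n * ∑ d ∈ Finset.range (n - 1), (y (d + 1) - y d) ^ 2) :=
      mul_le_mul_of_nonneg_left h3 (Nat.cast_nonneg n)
    have h6 : 0 ≤ (n : ℝ) * y 0 ^ 2 := by positivity
    linarith [sq (n : ℝ), mul_assoc (n : ℝ) n
      (∑ d ∈ Finset.range (n - 1), (y (d + 1) - y d) ^ 2)]
  have hn0 : (0 : ℝ) < n := by exact_mod_cast hpos
  have hfin : κ / (2 * (n : ℝ) ^ 2) * ∑ i, z 0 i ^ 2 ≤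
      κ / 2 * ∑ d ∈ Finset.range (n - 1), (y (d + 1) - y d) ^ 2 := by
    refine (mul_le_mul_of_nonneg_left hspread (by positivity)).trans_eq ?_
    field_simp
  linarith [htotal B]

theorem IsMixing.sum_sq_antitone (hκ : 0 < κ) (h : IsMixing κ B edge W) {z : ℕ → V → ℝ}
    (hz : ∀ t, z (t + 1) = (W t).mulVec (z t)) : Antitone fun t => ∑ i, z t i ^ 2 := by
  refine antitone_nat_of_succ_le fun t => ?_
  have := sum_sq_mulVec (h.row_sum t) (h.col_sum t) (z t)
  rw [← hz] at this
  have h1 : 0 ≤ ∑ k, ∑ i, W t k i * (z t i - z (t + 1) k) ^ 2 := Finset.sum_nonneg fun k _ =>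
    Finset.sum_nonneg fun i _ => mul_nonneg (h.nonneg hκ t k i) (sq_nonneg _)
  linarith

theorem sum_mulVec {M : Matrix V V ℝ} (hcol : ∀ j, ∑ i, M i j = 1) (z : V → ℝ) :
    ∑ i, M.mulVec z i = ∑ i, z i := by
  simp only [Matrix.mulVec, dotProduct]
  rw [Finset.sum_comm]
  simp [← Finset.sum_mul, hcol]

/-- Iterates the contraction over `m` windows, shifting time after each; hence the quantification
over `edge` and `W`. From `1 - 2a ≤ (1 - a)²` with `a = κ / (4 n²)`, the Euclidean norm contracts by
`1 - a` per window. -/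
theorem IsMixing.sum_sq_le_pow (hκ : 0 < κ) [Nonempty V] (m : ℕ) :
    ∀ {edge : ℕ → V → V → Prop} {W : ℕ → Matrix V V ℝ}, IsMixing κ B edge W →
    ∀ {z : ℕ → V → ℝ}, (∀ t, z (t + 1) = (W t).mulVec (z t)) → ∑ i, z 0 i = 0 →
    ∑ i, z (B * m) i ^ 2 ≤ (1 - κ / (4 * (Fintype.card V : ℝ) ^ 2)) ^ (2 * m) *
      ∑ i, z 0 i ^ 2 := by
  induction m with
  | zero => intros; simp
  | succ m ih =>
    intro edge W h z hz h0
    have hsum : ∀ t, ∑ i, z t i = 0 := by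
      intro t
      induction t with
      | zero => exact h0
      | succ t iht => rw [hz, sum_mulVec (h.col_sum t), iht]
    have h1 := ih (h.shift B) (z := fun t => z (B + t)) (fun t => hz (B + t)) (hsum _)
    have h2 := h.sum_sq_le hκ hz h0
    have hn : (1 : ℝ) ≤ (Fintype.card V : ℝ) ^ 2 := by
      exact one_le_pow₀ (by exact_mod_cast Fintype.card_pos (α := V))
    have h3 : 1 - κ / (2 * (Fintype.card V : ℝ) ^ 2) ≤
        (1 - κ / (4 * (Fintype.card V : ℝ) ^ 2)) ^ 2 := by
      have : κ / (2 * (Fintype.card V : ℝ) ^ 2) = 2 * (κ / (4 * (Fintype.card V : ℝ) ^ 2)) := by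
        field_simp; norm_num
      rw [this]
      nlinarith [sq_nonneg (κ / (4 * (Fintype.card V : ℝ) ^ 2))]
    have h4 : ∑ i, z B i ^ 2 ≤
        (1 - κ / (4 * (Fintype.card V : ℝ) ^ 2)) ^ 2 * ∑ i, z 0 i ^ 2 :=
      h2.trans (mul_le_mul_of_nonneg_right h3 (Finset.sum_nonneg fun _ _ => sq_nonneg _))
    have h5 : B * (m + 1) = B + B * m := by ring
    rw [h5]
    refine h1.trans ?_
    rw [show 2 * (m + 1) = 2 * m + 2 by ring, pow_add, mul_assoc]
    exact mul_le_mul_of_nonneg_left h4 (Even.pow_nonneg (even_two_mul m) _)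

end Consensus

/-! ### The constants `Γ` and `θ` -/

section Rates

/-- The contraction factor is in `(0, 1)`. -/
theorem contraction_mem {κ : ℝ} (hκ : 0 < κ) (hκ₁ : κ < 1) {n : ℕ} (hn : 1 ≤ n) :
    0 < 1 - κ / (4 * (n : ℝ) ^ 2) ∧ 1 - κ / (4 * (n : ℝ) ^ 2) < 1 := by
  have h1 : (1 : ℝ) ≤ (n : ℝ) ^ 2 := one_le_pow₀ (by exact_mod_cast hn)
  have h2 : 0 < κ / (4 * (n : ℝ) ^ 2) := by positivity
  have h3 : κ / (4 * (n : ℝ) ^ 2) < 1 := by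
    rw [div_lt_one (by positivity)]
    linarith
  constructor <;> linarith

theorem theta_mem {κ : ℝ} (hκ : 0 < κ) (hκ₁ : κ < 1) {n B : ℕ} (hn : 1 ≤ n) (hB : 1 ≤ B) :
    0 < theta κ n B ∧ theta κ n B < 1 := by
  obtain ⟨h1, h2⟩ := contraction_mem hκ hκ₁ hn
  exact ⟨Real.rpow_pos_of_pos h1 _, Real.rpow_lt_one h1.le h2
    (one_div_pos.2 (by exact_mod_cast hB))⟩

theorem Gam_pos {κ : ℝ} (hκ : 0 < κ) (hκ₁ : κ < 1) {n : ℕ} (hn : 1 ≤ n) : 0 < Gam κ n :=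
  zpow_pos (contraction_mem hκ hκ₁ hn).1 _

/-- Passes from completed windows to single steps: the right side is `q ^ (t / B - 2)` with real
exponent, and the integer quotient exceeds `t / B - 1`. Thus one of the two factors `q⁻¹` in `Γ`
would suffice. -/
theorem pow_div_le_Gam_mul_theta_pow {κ : ℝ} (hκ : 0 < κ) (hκ₁ : κ < 1) {n B : ℕ} (hn : 1 ≤ n)
    (hB : 1 ≤ B) (t : ℕ) :
    (1 - κ / (4 * (n : ℝ) ^ 2)) ^ (t / B) ≤ Gam κ n * theta κ n B ^ t := by
  obtain ⟨h1, h2⟩ := contraction_mem hκ hκ₁ hn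
  unfold Gam theta
  set q := 1 - κ / (4 * (n : ℝ) ^ 2)
  have hB0 : (0 : ℝ) < B := by exact_mod_cast hB
  rw [← Real.rpow_natCast, ← Real.rpow_natCast, ← Real.rpow_intCast, ← Real.rpow_mul h1.le,
    ← Real.rpow_add h1]
  refine Real.rpow_le_rpow_of_exponent_ge h1 h2.le ?_
  have h3 : t < B * (t / B) + B := by
    have := Nat.div_add_mod t B
    have := Nat.mod_lt t hB
    omega
  have h4 : (t : ℝ) < B * ((t / B : ℕ) : ℝ) + B := by exact_mod_cast h3
  have h5 : (t : ℝ) / B < ((t / B : ℕ) : ℝ) + 1 := by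
    rw [div_lt_iff₀ hB0]; linarith
  push_cast
  have h6 : 1 / (B : ℝ) * t = t / B := by ring
  rw [h6]
  linarith

end Rates

end DSMD

namespace DSMD

/-! ### Products of mixing matrices and perturbed averaging -/

section Transition

variable {V : Type*} [Fintype V] {κ : ℝ} {B : ℕ} {edge : ℕ → V → V → Prop}
  {W : ℕ → Matrix V V ℝ}

open Classical in
/-- The product `W (s + k - 1) ⋯ W (s + 1) W s` of `k` consecutive mixing matrices. -/
noncomputable def transition (W : ℕ → Matrix V V ℝ) (s : ℕ) : ℕ → Matrix V V ℝ
  | 0 => 1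
  | k + 1 => W (s + k) * transition W s k

/-- The `j`-th column minus `1 / n` evolves by averaging, has mean zero, and starts from a vector
with sum of squares at most `1`. An entry is bounded by the Euclidean norm, which is compared at the
last completed window before `t`. -/
theorem IsMixing.abs_transition_sub_le (hκ : 0 < κ) (hκ₁ : κ < 1) (h : IsMixing κ B edge W)
    (s t : ℕ) (i j : V) : |transition W s t i j - 1 / (Fintype.card V : ℝ)| ≤
      Gam κ (Fintype.card V) * theta κ (Fintype.card V) B ^ t := by
  classical
  have : Nonempty V := ⟨i⟩
  have hn : 1 ≤ Fintype.card V := Fintype.card_pos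
  have hn0 : (Fintype.card V : ℝ) ≠ 0 := by positivity
  let z : ℕ → V → ℝ := fun t i => transition W s t i j - 1 / (Fintype.card V : ℝ)
  have hz : ∀ t, z (t + 1) = (W (s + t)).mulVec (z t) := by
    intro t
    ext k
    simp only [z, transition, Matrix.mul_apply, Matrix.mulVec, dotProduct, mul_sub,
      Finset.sum_sub_distrib, ← Finset.sum_mul, h.row_sum, one_mul]
  have hdelta : ∀ k, z 0 k = (if k = j then 1 else 0) - 1 / (Fintype.card V : ℝ) := fun k => by
    simp [z, transition, Matrix.one_apply]
  have h0 : ∑ k, z 0 k = 0 := by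
    simp [hdelta, hn0]
  have h1 : ∑ k, z 0 k ^ 2 ≤ 1 := by
    have : ∀ k, z 0 k ^ 2 = (if k = j then 1 - 2 / (Fintype.card V : ℝ) else 0) +
        (1 / (Fintype.card V : ℝ)) ^ 2 := fun k => by
      rw [hdelta]
      split_ifs <;> ring
    simp only [this, Finset.sum_add_distrib, Finset.sum_ite_eq', Finset.mem_univ, if_true,
      Finset.sum_const, Finset.card_univ, nsmul_eq_mul]
    have h2 : (Fintype.card V : ℝ) * (1 / (Fintype.card V : ℝ)) ^ 2 =
        1 / (Fintype.card V : ℝ) := by field_simp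
    have h3 : 0 < 1 / (Fintype.card V : ℝ) := by positivity
    rw [h2, show 2 / (Fintype.card V : ℝ) = 2 * (1 / (Fintype.card V : ℝ)) by ring]
    linarith
  obtain ⟨hq0, -⟩ := contraction_mem hκ hκ₁ hn
  have h2 := (h.shift s).sum_sq_le_pow hκ (t / B) hz h0
  have h3 : ∑ k, z t k ^ 2 ≤ ∑ k, z (B * (t / B)) k ^ 2 :=
    (h.shift s).sum_sq_antitone hκ hz (Nat.mul_div_le t B)
  have h4 : z t i ^ 2 ≤ ∑ k, z t k ^ 2 :=
    Finset.single_le_sum (f := fun k => z t k ^ 2) (fun k _ => sq_nonneg _) (Finset.mem_univ i)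
  have h5 : z t i ^ 2 ≤ ((1 - κ / (4 * (Fintype.card V : ℝ) ^ 2)) ^ (t / B)) ^ 2 := by
    rw [← pow_mul, mul_comm (t / B) 2]
    have := mul_le_mul_of_nonneg_left h1 (pow_nonneg hq0.le (2 * (t / B)))
    linarith
  exact (abs_le_of_sq_le_sq h5 (by positivity)).trans
    (pow_div_le_Gam_mul_theta_pow hκ hκ₁ hn h.one_le t)

variable {E : Type*} [NormedAddCommGroup E] [NormedSpace ℝ E]

/-- Variation of constants for perturbed averaging. -/
theorem eq_sum_transition {x e : ℕ → V → E}
    (hx : ∀ t i, x (t + 1) i = ∑ j, W t i j • x t j + e t i) (t : ℕ) : ∀ i,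
    x t i = ∑ j, transition W 0 t i j • x 0 j +
      ∑ s ∈ Finset.range t, ∑ j, transition W (s + 1) (t - 1 - s) i j • e s j := by
  classical
  have hact : ∀ (M N : Matrix V V ℝ) (y : V → E) (i : V),
      ∑ k, M i k • ∑ j, N k j • y j = ∑ j, (M * N) i j • y j := by
    intro M N y i
    simp only [Matrix.mul_apply, Finset.smul_sum, Finset.sum_smul, smul_smul]
    exact Finset.sum_comm
  induction t with
  | zero => intro i; simp [transition, Matrix.one_apply]
  | succ t ih =>
    intro i
    rw [hx, Finset.sum_range_succ]
    simp only [ih, smul_add, Finset.sum_add_distrib, hact]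
    have h1 : ∑ j, transition W (t + 1) (t + 1 - 1 - t) i j • e t j = e t i := by
      simp [transition, Matrix.one_apply]
    have h2 : ∑ k, W t i k • ∑ s ∈ Finset.range t, ∑ j, transition W (s + 1) (t - 1 - s) k j • e s j
        = ∑ s ∈ Finset.range t, ∑ j, transition W (s + 1) (t + 1 - 1 - s) i j • e s j := by
      simp only [Finset.smul_sum (s := Finset.range t)]
      rw [Finset.sum_comm]
      refine Finset.sum_congr rfl fun s hs => ?_
      have hs' := Finset.mem_range.1 hs
      rw [hact, show t + 1 - 1 - s = (t - 1 - s) + 1 by omega, transition,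
        show s + 1 + (t - 1 - s) = t by omega]
    rw [h1, h2, show transition W 0 (t + 1) = W t * transition W 0 t by simp [transition]]
    abel

theorem sum_eq_of_perturbed {x e : ℕ → V → E} (hcol : ∀ t j, ∑ i, W t i j = 1)
    (hx : ∀ t i, x (t + 1) i = ∑ j, W t i j • x t j + e t i) (t : ℕ) :
    ∑ i, x t i = ∑ j, x 0 j + ∑ s ∈ Finset.range t, ∑ j, e s j := by
  induction t with
  | zero => simp
  | succ t ih =>
    simp only [hx, Finset.sum_add_distrib]
    rw [Finset.sum_comm]
    simp only [← Finset.sum_smul, hcol, one_smul]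
    rw [ih, Finset.sum_range_succ]
    abel

/-- The disagreement of perturbed averaging. -/
theorem IsMixing.norm_sub_mean_le (hκ : 0 < κ) (hκ₁ : κ < 1) (h : IsMixing κ B edge W)
    {x e : ℕ → V → E} (hx : ∀ t i, x (t + 1) i = ∑ j, W t i j • x t j + e t i) (t : ℕ) (i : V) :
    ‖x t i - (1 / (Fintype.card V : ℝ)) • ∑ j, x t j‖ ≤
      Gam κ (Fintype.card V) * (theta κ (Fintype.card V) B ^ t * ∑ j, ‖x 0 j‖ +
        ∑ s ∈ Finset.range t, theta κ (Fintype.card V) B ^ (t - 1 - s) * ∑ j, ‖e s j‖) := by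
  -- Averaging preserves the total, so the mean obeys the same formula with every transition entry
  -- replaced by `1 / n`.
  have hdiff : x t i - (1 / (Fintype.card V : ℝ)) • ∑ j, x t j =
      ∑ j, (transition W 0 t i j - 1 / (Fintype.card V : ℝ)) • x 0 j +
      ∑ s ∈ Finset.range t, ∑ j,
        (transition W (s + 1) (t - 1 - s) i j - 1 / (Fintype.card V : ℝ)) • e s j := by
    rw [sum_eq_of_perturbed h.col_sum hx, eq_sum_transition hx t i]
    simp only [sub_smul, Finset.sum_sub_distrib, smul_add, Finset.smul_sum]
    abel
  have hterm : ∀ (s k : ℕ) (y : V → E),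
      ‖∑ j, (transition W s k i j - 1 / (Fintype.card V : ℝ)) • y j‖ ≤
        Gam κ (Fintype.card V) * theta κ (Fintype.card V) B ^ k * ∑ j, ‖y j‖ := by
    intro s k y
    refine (norm_sum_le _ _).trans ?_
    rw [Finset.mul_sum]
    refine Finset.sum_le_sum fun j _ => ?_
    rw [norm_smul, Real.norm_eq_abs]
    exact mul_le_mul_of_nonneg_right (h.abs_transition_sub_le hκ hκ₁ s k i j) (norm_nonneg _)
  rw [hdiff, mul_add, ← mul_assoc, Finset.mul_sum (Finset.range t)]
  refine (norm_add_le _ _).trans (add_le_add (hterm _ _ _) ((norm_sum_le _ _).trans ?_))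
  refine Finset.sum_le_sum fun s _ => ?_
  rw [← mul_assoc]
  exact hterm _ _ _

end Transition

/-! ### Geometric and harmonic sums -/

section Sums

theorem sum_Icc_one_eq_sum_range (f : ℕ → ℝ) (T : ℕ) :
    ∑ t ∈ Finset.Icc 1 T, f t = ∑ t ∈ Finset.range T, f (t + 1) := by
  rw [← Finset.Ico_add_one_right_eq_Icc, Finset.sum_Ico_eq_sum_range]
  simp [add_comm]

theorem sum_pow_le {θ : ℝ} (h0 : 0 < θ) (h1 : θ < 1) (s : Finset ℕ) :
    ∑ t ∈ s, θ ^ t ≤ 1 / (1 - θ) := by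
  rw [one_div, ← tsum_geometric_of_lt_one h0.le h1]
  exact (summable_geometric_of_lt_one h0.le h1).sum_le_tsum s fun t _ => by positivity

/-- Summation of a convolution with a geometric sequence. -/
theorem sum_conv_pow_le {θ : ℝ} (h0 : 0 < θ) (h1 : θ < 1) {a : ℕ → ℝ} (ha : ∀ s, 0 ≤ a s) (T : ℕ) :
    ∑ t ∈ Finset.Icc 1 T, ∑ s ∈ Finset.range t, θ ^ (t - 1 - s) * a s ≤
      1 / (1 - θ) * ∑ s ∈ Finset.range T, a s := by
  rw [sum_Icc_one_eq_sum_range, Finset.sum_comm' (s' := fun s => Finset.Ico s T)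
    (t' := Finset.range T) (by intro x y; simp only [Finset.mem_range, Finset.mem_Ico]; omega),
    Finset.mul_sum]
  refine Finset.sum_le_sum fun s _ => ?_
  rw [← Finset.sum_mul]
  refine mul_le_mul_of_nonneg_right ?_ (ha s)
  rw [Finset.sum_Ico_eq_sum_range]
  refine le_trans (le_of_eq (Finset.sum_congr rfl fun k _ => ?_)) (sum_pow_le h0 h1 (Finset.range _))
  rw [show s + k + 1 - 1 - s = k by omega]

theorem sum_inv_succ_le {T : ℕ} : ∑ t ∈ Finset.range T, 1 / ((t : ℝ) + 1) ≤ 1 + Real.log T := by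
  have h := harmonic_le_one_add_log T
  simp only [harmonic, Rat.cast_sum, Rat.cast_inv, Rat.cast_natCast] at h
  refine le_trans (le_of_eq (Finset.sum_congr rfl fun t _ => ?_)) h
  push_cast
  rw [one_div]

end Sums

end DSMD

namespace DSMD

/-! ### The information flow -/

section Past

variable {Ω : Type*} [mΩ : MeasurableSpace Ω] {d : ℕ} {E F V V' : Type*}
  [NormedAddCommGroup E] [NormedSpace ℝ E] [NormedAddCommGroup F] [NormedSpace ℝ F]
  [MeasurableSpace E] [MeasurableSpace F]
  {R : Run Ω E V d} {R' : Run Ω F V' d}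

omit mΩ in
theorem past_mono : Monotone (past R R') := by
  intro s t hst
  have h : Set.Iio s ⊆ Set.Iio t := Set.Iio_subset_Iio hst
  exact sup_le_sup (sup_le_sup le_rfl (biSup_mono fun _ hi => h hi)) (biSup_mono fun _ hi => h hi)

theorem past_le (hx : ∀ i, Measurable (R.x 0 i)) (hx' : ∀ i, Measurable (R'.x 0 i))
    (hξ : ∀ t i, Measurable (R.ξ t i)) (hξ' : ∀ t i, Measurable (R'.ξ t i)) (t : ℕ) :
    past R R' t ≤ mΩ :=
  sup_le (sup_le (sup_le (iSup_le fun i => (hx i).comap_le) (iSup_le fun i => (hx' i).comap_le))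
    (iSup₂_le fun s _ => iSup_le fun i => (hξ s i).comap_le))
    (iSup₂_le fun s _ => iSup_le fun i => (hξ' s i).comap_le)

omit mΩ in
theorem measurable_past_init (i : V) : Measurable[past R R' 0] (R.x 0 i) :=
  Measurable.of_comap_le ((le_iSup (fun i => MeasurableSpace.comap (R.x 0 i) inferInstance) i).trans
    (le_sup_left.trans (le_sup_left.trans le_sup_left)))

omit mΩ in
theorem measurable_past_init' (i : V') : Measurable[past R R' 0] (R'.x 0 i) :=
  Measurable.of_comap_le ((le_iSup (fun i => MeasurableSpace.comap (R'.x 0 i) inferInstance) i).trans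
    (le_sup_right.trans (le_sup_left.trans le_sup_left)))

end Past

/-! ### Iterates: membership, adaptedness, pathwise disagreement -/

section Trajectory

variable {Ω : Type*} [mΩ : MeasurableSpace Ω] {d : ℕ} {E F V V' : Type*}
  [NormedAddCommGroup E] [NormedSpace ℝ E] [FiniteDimensional ℝ E]
  [MeasurableSpace E] [BorelSpace E]
  [NormedAddCommGroup F] [NormedSpace ℝ F] [Fintype V] [Fintype V']
  {N : Network E F V V' d} {X' : Set F} {κ : ℝ} {B : ℕ} {P : Measure Ω} {ξ : Ω → Fin d → ℝ}
  {R : Run Ω E V d} {R' : Run Ω F V' d} {ℱ : ℕ → MeasurableSpace Ω} {α : ℕ → ℝ}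

omit [FiniteDimensional ℝ E] [BorelSpace E] in
theorem Network.Follows.x_mem (h : N.Follows ℱ R R' α) (t : ℕ) (i : V) (ω : Ω) :
    R.x t i ω ∈ N.X := by
  cases t with
  | zero => exact h.init_mem i ω
  | succ t => exact (h.update t i ω).1

omit [FiniteDimensional ℝ E] [MeasurableSpace E] [BorelSpace E] in
theorem Network.IsValid.v_mem (hκ : 0 < κ) (hN : N.IsValid X' κ B P ξ)
    (hx : ∀ t i ω, R.x t i ω ∈ N.X) (t : ℕ) (i : V) (ω : Ω) : N.v R t i ω ∈ N.X :=
  hN.convex.sum_mem (fun j _ => hN.mixing.nonneg hκ t i j) (hN.mixing.row_sum t i)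
    fun j _ => hx t j ω

omit [FiniteDimensional ℝ E] [MeasurableSpace E] [BorelSpace E] in
theorem Network.IsValid.u_mem (hN : N.IsValid X' κ B P ξ) (hX' : Convex ℝ X')
    (hx : ∀ t i ω, R'.x t i ω ∈ X') (t : ℕ) (i : V) (ω : Ω) : N.u R' t i ω ∈ X' :=
  hX'.sum_mem (fun j _ => hN.crossMixing.nonneg t i j) (hN.crossMixing.row_sum t i)
    fun j _ => hx t j ω

omit mΩ [NormedAddCommGroup F] [NormedSpace ℝ F] [Fintype V'] in
theorem Network.measurable_v {m : MeasurableSpace Ω} {t : ℕ} (hx : ∀ i, Measurable[m] (R.x t i))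
    (i : V) : Measurable[m] (N.v R t i) := by
  have := FiniteDimensional.proper ℝ E
  exact Finset.measurable_fun_sum _ fun j _ => (hx j).const_smul _

omit mΩ [NormedAddCommGroup F] [NormedSpace ℝ F] [Fintype V'] in
theorem Network.measurable_u {N : Network F E V' V d} {m : MeasurableSpace Ω} {t : ℕ}
    (hx : ∀ i, Measurable[m] (R.x t i))
    (i : V') : Measurable[m] (N.u R t i) := by
  have := FiniteDimensional.proper ℝ E
  exact Finset.measurable_fun_sum _ fun j _ => (hx j).const_smul _

/-- The estimates at time `t` depend on the information available at time `t` only. -/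
theorem Network.Follows.measurable_x (hκ : 0 < κ) (hN : N.IsValid X' κ B P ξ)
    (h : N.Follows ℱ R R' α) (hℱ : Monotone ℱ) (h0 : ∀ i, Measurable[ℱ 0] (R.x 0 i)) (t : ℕ) :
    ∀ i, Measurable[ℱ t] (R.x t i) := by
  induction t with
  | zero => exact h0
  | succ t ih =>
    intro i
    have hv : Measurable[ℱ (t + 1)] (N.v R t i) :=
      (Network.measurable_v ih i).mono (hℱ (Nat.le_succ t)) le_rfl
    have hy : Measurable[ℱ (t + 1)] fun ω => -(α t • R.ghat t i ω) :=
      ((h.measurable_ghat t i).const_smul (α t)).neg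
    exact measurable_prox hN.differentiable_reg hN.strongConvex_reg hv (hN.v_mem hκ h.x_mem t i) hy
      (h.update t i)

omit [FiniteDimensional ℝ E] [BorelSpace E] in
theorem Network.Follows.norm_x_sub_v_le (hκ : 0 < κ) (hN : N.IsValid X' κ B P ξ)
    (h : N.Follows ℱ R R' α) (hα : ∀ t, 0 ≤ α t) (t : ℕ) (i : V) (ω : Ω) :
    ‖R.x (t + 1) i ω - N.v R t i ω‖ ≤ α t * ‖R.ghat t i ω‖ := by
  have := (h.update t i ω).norm_sub_le hN.differentiable_reg hN.strongConvex_reg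
    (hN.v_mem hκ h.x_mem t i ω)
  rwa [norm_neg, norm_smul, Real.norm_of_nonneg (hα t)] at this

/-- The average of the estimates of all agents. -/
noncomputable def Run.mean (R : Run Ω E V d) (t : ℕ) (ω : Ω) : E :=
  (1 / (Fintype.card V : ℝ)) • ∑ j, R.x t j ω

omit [FiniteDimensional ℝ E] [BorelSpace E] in
-- The algorithm is perturbed averaging with perturbation `x(t + 1) - v(t)`, whose norm is at most
-- `α ‖ĝ‖` because the prox-mapping moves the base point by at most the dual norm of its argument.
theorem Network.Follows.norm_x_sub_mean_le (hκ : 0 < κ) (hκ₁ : κ < 1)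
    (hN : N.IsValid X' κ B P ξ) (h : N.Follows ℱ R R' α) (hα : ∀ t, 0 ≤ α t) (t : ℕ) (i : V)
    (ω : Ω) : ‖R.x t i ω - R.mean t ω‖ ≤
      Gam κ (Fintype.card V) * (theta κ (Fintype.card V) B ^ t * ∑ j, ‖R.x 0 j ω‖ +
        ∑ s ∈ Finset.range t, theta κ (Fintype.card V) B ^ (t - 1 - s) *
          ∑ j, α s * ‖R.ghat s j ω‖) := by
  have : Nonempty V := ⟨i⟩
  have hn : 1 ≤ Fintype.card V := Fintype.card_pos
  refine (hN.mixing.norm_sub_mean_le hκ hκ₁ (x := fun t j => R.x t j ω)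
    (e := fun t j => R.x (t + 1) j ω - N.v R t j ω) (fun t j => ?_) t i).trans ?_
  · simp [Network.v]
  · have hθ := (theta_mem hκ hκ₁ hn hN.mixing.one_le).1
    have hΓ := Gam_pos hκ hκ₁ hn
    gcongr
    exact h.norm_x_sub_v_le hκ hN hα _ _ ω

end Trajectory

/-! ### Moments of the sampled subgradients and orthogonality of the noise -/

section Oracle

variable {Ω : Type*} [mΩ : MeasurableSpace Ω] {d : ℕ} {E F V V' : Type*}
  [NormedAddCommGroup E] [NormedSpace ℝ E]
  [NormedAddCommGroup F] [NormedSpace ℝ F] [Fintype V] [Fintype V']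
  {N : Network E F V V' d} {X' : Set F} {κ : ℝ} {B : ℕ} {P : Measure Ω} {ξ : Ω → Fin d → ℝ}
  {R : Run Ω E V d} {R' : Run Ω F V' d} {ℱ : ℕ → MeasurableSpace Ω} {ν L : ℝ}

theorem Network.UnbiasedOracle.ae_norm_g_le (hκ : 0 < κ) (hN : N.IsValid X' κ B P ξ)
    (hLip : N.LipschitzCosts X' P ξ L) (hL : 0 ≤ L) (hor : N.UnbiasedOracle P ξ ℱ R R' ν)
    (hx : ∀ t i ω, R.x t i ω ∈ N.X) (hu : ∀ t i ω, N.u R' t i ω ∈ X') (t : ℕ) (i : V) :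
    ∀ᵐ ω ∂P, ‖R.g t i ω‖ ≤ L := by
  filter_upwards [hor.g_mem t i] with ω hω
  exact norm_le_of_mem_subdiff hN.isOpen hL
    (fun x hx x' hx' => hLip.lipschitz_own i x hx x' hx' _ (hu t i ω))
    (hN.subset (hN.v_mem hκ hx t i ω)) hω

variable [IsProbabilityMeasure P]

omit [IsProbabilityMeasure P] in
theorem Network.UnbiasedOracle.integrable_g (hor : N.UnbiasedOracle P ξ ℱ R R' ν) (t : ℕ) (i : V) :
    Integrable (R.g t i) P :=
  integrable_condExp.congr (hor.unbiased t i)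

theorem Network.UnbiasedOracle.integral_sq_le (hℱ : ∀ t, ℱ t ≤ mΩ)
    (hor : N.UnbiasedOracle P ξ ℱ R R' ν) (t : ℕ) (i : V) :
    ∫ ω, ‖R.g t i ω - R.ghat t i ω‖ ^ 2 ∂P ≤ ν ^ 2 := by
  rw [← integral_condExp (hℱ t)]
  calc _ ≤ ∫ _, ν ^ 2 ∂P :=
        integral_mono_ae integrable_condExp (integrable_const _) (hor.variance_le t i)
    _ = ν ^ 2 := by simp

/-- Integrates `a ≤ a² / (2ν) + ν / 2`, which is tight at `a = ν`. -/
theorem Network.UnbiasedOracle.integral_norm_le (hν : 0 < ν) (hℱ : ∀ t, ℱ t ≤ mΩ)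
    (hor : N.UnbiasedOracle P ξ ℱ R R' ν) (t : ℕ) (i : V) :
    ∫ ω, ‖R.g t i ω - R.ghat t i ω‖ ∂P ≤ ν := by
  have h1 : ∀ ω, ‖R.g t i ω - R.ghat t i ω‖ ≤
      1 / (2 * ν) * ‖R.g t i ω - R.ghat t i ω‖ ^ 2 + ν / 2 := by
    intro ω
    have h2 := sq_nonneg (‖R.g t i ω - R.ghat t i ω‖ - ν)
    have h3 : 1 / (2 * ν) * ‖R.g t i ω - R.ghat t i ω‖ ^ 2 + ν / 2 -
      ‖R.g t i ω - R.ghat t i ω‖ = 1 / (2 * ν) * (‖R.g t i ω - R.ghat t i ω‖ - ν) ^ 2 := by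
      field_simp; ring
    have h4 : 0 ≤ 1 / (2 * ν) * (‖R.g t i ω - R.ghat t i ω‖ - ν) ^ 2 := by positivity
    linarith
  have hint := (hor.integrable_sq t i).const_mul (1 / (2 * ν))
  calc ∫ ω, ‖R.g t i ω - R.ghat t i ω‖ ∂P
      ≤ ∫ ω, (1 / (2 * ν) * ‖R.g t i ω - R.ghat t i ω‖ ^ 2 + ν / 2) ∂P :=
        integral_mono ((hor.integrable_g t i).sub (hor.integrable t i)).norm
          (hint.add (integrable_const _)) h1
    _ = 1 / (2 * ν) * ∫ ω, ‖R.g t i ω - R.ghat t i ω‖ ^ 2 ∂P + ν / 2 := by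
        rw [integral_add hint (integrable_const _), integral_const_mul]
        simp
    _ ≤ 1 / (2 * ν) * ν ^ 2 + ν / 2 := by
        gcongr
        exact hor.integral_sq_le hℱ t i
    _ = ν := by field_simp; norm_num

theorem Network.UnbiasedOracle.integral_norm_ghat_le (hν : 0 < ν) (hℱ : ∀ t, ℱ t ≤ mΩ)
    (hor : N.UnbiasedOracle P ξ ℱ R R' ν) {t : ℕ} {i : V} (hg : ∀ᵐ ω ∂P, ‖R.g t i ω‖ ≤ L) :
    ∫ ω, ‖R.ghat t i ω‖ ∂P ≤ L + ν := by
  have hint := ((hor.integrable_g t i).sub (hor.integrable t i)).norm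
  calc ∫ ω, ‖R.ghat t i ω‖ ∂P ≤ ∫ ω, (L + ‖R.g t i ω - R.ghat t i ω‖) ∂P := by
        refine integral_mono_ae (hor.integrable t i).norm ((integrable_const L).add hint) ?_
        filter_upwards [hg] with ω hω
        have := norm_le_norm_add_norm_sub (R.g t i ω) (R.ghat t i ω)
        linarith
    _ = L + ∫ ω, ‖R.g t i ω - R.ghat t i ω‖ ∂P := by
        have : Integrable (fun ω => ‖R.g t i ω - R.ghat t i ω‖) P := hint
        rw [integral_add (integrable_const _) this]
        simp
    _ ≤ L + ν := by gcongr; exact hor.integral_norm_le hν hℱ t i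

/-- Expands `(L + ‖g - ĝ‖)²` and bounds the first two moments of the error by `ν` and `ν²`. -/
theorem Network.UnbiasedOracle.sq_norm_ghat_le (hν : 0 < ν) (hL : 0 ≤ L) (hℱ : ∀ t, ℱ t ≤ mΩ)
    (hor : N.UnbiasedOracle P ξ ℱ R R' ν) {t : ℕ} {i : V} (hg : ∀ᵐ ω ∂P, ‖R.g t i ω‖ ≤ L) :
    Integrable (fun ω => ‖R.ghat t i ω‖ ^ 2) P ∧ ∫ ω, ‖R.ghat t i ω‖ ^ 2 ∂P ≤ (L + ν) ^ 2 := by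
  have hint : Integrable (fun ω => ‖R.g t i ω - R.ghat t i ω‖) P :=
    ((hor.integrable_g t i).sub (hor.integrable t i)).norm
  have hint1 : Integrable (fun ω => L ^ 2 + 2 * L * ‖R.g t i ω - R.ghat t i ω‖) P :=
    (integrable_const _).add (hint.const_mul _)
  have hint2 : Integrable (fun ω => L ^ 2 + 2 * L * ‖R.g t i ω - R.ghat t i ω‖ +
      ‖R.g t i ω - R.ghat t i ω‖ ^ 2) P := hint1.add (hor.integrable_sq t i)
  have hle : ∀ᵐ ω ∂P, ‖R.ghat t i ω‖ ^ 2 ≤ L ^ 2 + 2 * L * ‖R.g t i ω - R.ghat t i ω‖ +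
      ‖R.g t i ω - R.ghat t i ω‖ ^ 2 := by
    filter_upwards [hg] with ω hω
    have h1 := norm_le_norm_add_norm_sub (R.g t i ω) (R.ghat t i ω)
    have h2 : ‖R.ghat t i ω‖ ≤ L + ‖R.g t i ω - R.ghat t i ω‖ := by linarith
    have h3 := pow_le_pow_left₀ (norm_nonneg _) h2 2
    linarith
  have hint3 : Integrable (fun ω => ‖R.ghat t i ω‖ ^ 2) P := by
    refine hint2.mono' ((hor.integrable t i).aestronglyMeasurable.norm.pow 2) ?_
    filter_upwards [hle] with ω hω
    rwa [Real.norm_of_nonneg (by positivity)]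
  refine ⟨hint3, (integral_mono_ae hint3 hint2 hle).trans ?_⟩
  rw [integral_add hint1 (hor.integrable_sq t i),
    integral_add (integrable_const _) (hint.const_mul _), integral_const_mul]
  have h1 := hor.integral_sq_le hℱ t i
  have h2 := mul_le_mul_of_nonneg_left (hor.integral_norm_le hν hℱ t i)
    (by positivity : 0 ≤ 2 * L)
  simp only [integral_const, probReal_univ, smul_eq_mul, one_mul]
  nlinarith

variable [FiniteDimensional ℝ E] [MeasurableSpace E] [BorelSpace E]

/-- The error of the sampled subgradients is orthogonal to the past. -/
theorem Network.UnbiasedOracle.integral_noise_apply (hℱ : ∀ t, ℱ t ≤ mΩ)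
    (hor : N.UnbiasedOracle P ξ ℱ R R' ν) (t : ℕ) (i : V) {w : Ω → E} (hw : Measurable[ℱ t] w)
    {C : ℝ} (hC : ∀ ω, ‖w ω‖ ≤ C) :
    Integrable (fun ω => (R.g t i ω - R.ghat t i ω) (w ω)) P ∧
      ∫ ω, (R.g t i ω - R.ghat t i ω) (w ω) ∂P = 0 := by
  have := FiniteDimensional.proper ℝ E
  have happ : ∀ h : Ω → StrongDual ℝ E, Integrable h P → Integrable (fun ω => h ω (w ω)) P := by
    intro h hh
    refine (hh.norm.mul_const C).mono' ?_ (Eventually.of_forall fun ω => ?_)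
    · exact (isBoundedBilinearMap_apply (𝕜 := ℝ) (E := E) (F := ℝ)).continuous.comp_aestronglyMeasurable
        (hh.aestronglyMeasurable.prodMk (hw.mono (hℱ t) le_rfl).stronglyMeasurable.aestronglyMeasurable)
    · exact ((h ω).le_opNorm _).trans (mul_le_mul_of_nonneg_left (hC ω) (norm_nonneg _))
  have h1 := happ _ (hor.integrable t i)
  have h2 := happ _ (hor.integrable_g t i)
  refine ⟨by simp only [sub_apply]; exact h2.sub h1, ?_⟩
  simp only [sub_apply]
  rw [integral_sub h2 h1, sub_eq_zero]
  -- `w` is `ℱ t`-measurable, so it can be pulled out: the conditional expectation of `ĝ(w)` is that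
  -- of `ĝ` applied to `w`, namely `g(w)`.
  have hpull := condExp_bilin_of_stronglyMeasurable_right (μ := P) (m := ℱ t)
    (ContinuousLinearMap.id ℝ (StrongDual ℝ E)) (f := R.ghat t i) (g := w)
    hw.stronglyMeasurable h1 (hor.integrable t i)
  rw [← integral_condExp (hℱ t) (f := fun ω => R.ghat t i ω (w ω))]
  refine integral_congr_ae ?_
  filter_upwards [hpull, hor.unbiased t i] with ω hω1 hω2
  simp only [ContinuousLinearMap.id_apply] at hω1
  rw [hω1, hω2]

end Oracle

end DSMD

namespace DSMD

/-! ### Bounds on expectations that carry integrability along -/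

section MeanLE

variable {Ω : Type*} [MeasurableSpace Ω] {P : Measure Ω}

/-- `f` is integrable with expectation at most `c`. -/
def MeanLE (P : Measure Ω) (f : Ω → ℝ) (c : ℝ) : Prop :=
  Integrable f P ∧ ∫ ω, f ω ∂P ≤ c

theorem MeanLE.add {f g : Ω → ℝ} {a b : ℝ} (hf : MeanLE P f a) (hg : MeanLE P g b) :
    MeanLE P (fun ω => f ω + g ω) (a + b) :=
  ⟨hf.1.add hg.1, by rw [integral_add hf.1 hg.1]; exact add_le_add hf.2 hg.2⟩

theorem MeanLE.sum {ι : Type*} {s : Finset ι} {f : ι → Ω → ℝ} {a : ι → ℝ}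
    (hf : ∀ i ∈ s, MeanLE P (f i) (a i)) : MeanLE P (fun ω => ∑ i ∈ s, f i ω) (∑ i ∈ s, a i) :=
  ⟨integrable_finsetSum s fun i hi => (hf i hi).1, by
    rw [integral_finsetSum s fun i hi => (hf i hi).1]
    exact Finset.sum_le_sum fun i hi => (hf i hi).2⟩

theorem MeanLE.const_mul {f : Ω → ℝ} {a c : ℝ} (hc : 0 ≤ c) (hf : MeanLE P f a) :
    MeanLE P (fun ω => c * f ω) (c * a) :=
  ⟨hf.1.const_mul c, by rw [integral_const_mul]; exact mul_le_mul_of_nonneg_left hf.2 hc⟩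

theorem MeanLE.const [IsProbabilityMeasure P] (c : ℝ) : MeanLE P (fun _ => c) c :=
  ⟨integrable_const c, by simp⟩

theorem MeanLE.weaken {f : Ω → ℝ} {a b : ℝ} (hf : MeanLE P f a) (hab : a ≤ b) : MeanLE P f b :=
  ⟨hf.1, hf.2.trans hab⟩

theorem MeanLE.of_le {f g : Ω → ℝ} {c : ℝ} (hg : MeanLE P g c) (hf : AEStronglyMeasurable f P)
    (h0 : ∀ ω, 0 ≤ f ω) (hfg : ∀ ω, f ω ≤ g ω) : MeanLE P f c := by
  have hint : Integrable f P := hg.1.mono' hf (Eventually.of_forall fun ω => by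
    rw [Real.norm_of_nonneg (h0 ω)]; exact hfg ω)
  exact ⟨hint, (integral_mono hint hg.1 hfg).trans hg.2⟩

/-- Weighted averages of functions with common bound on the expectation. -/
theorem MeanLE.weighted {ι : Type*} [Fintype ι] {w : ι → ℝ} (hw : ∀ i, 0 ≤ w i)
    (hw1 : ∑ i, w i = 1) {f : ι → Ω → ℝ} {c : ℝ} (hf : ∀ i, MeanLE P (f i) c) :
    MeanLE P (fun ω => ∑ i, w i * f i ω) c := by
  have := MeanLE.sum (s := Finset.univ) fun i _ => (hf i).const_mul (hw i)
  rwa [← Finset.sum_mul, hw1, one_mul] at this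

end MeanLE

/-! ### Expected disagreement -/

section Disagreement

variable {Ω : Type*} [mΩ : MeasurableSpace Ω] {d : ℕ} {E F V V' : Type*}
  [NormedAddCommGroup E] [NormedSpace ℝ E] [FiniteDimensional ℝ E]
  [MeasurableSpace E] [BorelSpace E]
  [NormedAddCommGroup F] [NormedSpace ℝ F] [Fintype V] [Fintype V']
  {N : Network E F V V' d} {X' : Set F} {κ : ℝ} {B : ℕ} {P : Measure Ω} [IsProbabilityMeasure P]
  {ξ : Ω → Fin d → ℝ}
  {R : Run Ω E V d} {R' : Run Ω F V' d} {ℱ : ℕ → MeasurableSpace Ω} {α : ℕ → ℝ} {ν L : ℝ}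

/-- Bound on the expected disagreement at time `t`, for mean subgradient norms at most `G`. -/
noncomputable def disagreement (κ : ℝ) (n B : ℕ) (α : ℕ → ℝ) (Λ G : ℝ) (t : ℕ) : ℝ :=
  n * Gam κ n * (theta κ n B ^ t * Λ +
    ∑ s ∈ Finset.range t, theta κ n B ^ (t - 1 - s) * (α s * G))

theorem sum_disagreement_le {κ : ℝ} (hκ : 0 < κ) (hκ₁ : κ < 1) {n B : ℕ} (hn : 1 ≤ n) (hB : 1 ≤ B)
    {α : ℕ → ℝ} (hα : ∀ t, 0 ≤ α t) {Λ G : ℝ} (hΛ : 0 ≤ Λ) (hG : 0 ≤ G) (T : ℕ) :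
    ∑ t ∈ Finset.Icc 1 T, disagreement κ n B α Λ G t ≤
      n * Gam κ n / (1 - theta κ n B) * (Λ + G * ∑ s ∈ Finset.range T, α s) := by
  obtain ⟨h0, h1⟩ := theta_mem hκ hκ₁ hn hB
  have hΓ := Gam_pos hκ hκ₁ hn
  unfold disagreement
  rw [← Finset.mul_sum, Finset.sum_add_distrib, ← Finset.sum_mul]
  have h2 := mul_le_mul_of_nonneg_right (sum_pow_le h0 h1 (Finset.Icc 1 T)) hΛ
  have h3 := sum_conv_pow_le h0 h1 (a := fun s => α s * G) (fun s => mul_nonneg (hα s) hG) T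
  rw [← Finset.sum_mul] at h3
  refine (mul_le_mul_of_nonneg_left (add_le_add h2 h3) (by positivity)).trans_eq ?_
  ring

omit [NormedSpace ℝ E] [FiniteDimensional ℝ E] in
theorem meanLE_norm_le_iSup {X : Set E} (hX : IsCompact X) [SecondCountableTopology E]
    {x : V → Ω → E} (hx : ∀ i, Measurable (x i)) (hxX : ∀ i ω, x i ω ∈ X) (i : V) :
    MeanLE P (fun ω => ‖x i ω‖) (∫ ω, ⨆ j, ‖x j ω‖ ∂P) := by
  have : Nonempty V := ⟨i⟩
  obtain ⟨C, hC⟩ := hX.exists_bound_of_continuousOn (f := id) continuousOn_id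
  have hbdd : ∀ ω, BddAbove (Set.range fun j => ‖x j ω‖) := fun ω => Set.finite_range _ |>.bddAbove
  have hsup : ∀ ω, ⨆ j, ‖x j ω‖ ≤ C := fun ω => ciSup_le fun j => hC _ (hxX j ω)
  have hle : ∀ ω, ‖x i ω‖ ≤ ⨆ j, ‖x j ω‖ := fun ω => le_ciSup (hbdd ω) i
  have hint : Integrable (fun ω => ⨆ j, ‖x j ω‖) P := by
    refine (integrable_const C).mono' (Measurable.iSup fun j => (hx j).norm).aestronglyMeasurable
      (Eventually.of_forall fun ω => ?_)
    rw [Real.norm_of_nonneg ((norm_nonneg _).trans (hle ω))]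
    exact hsup ω
  exact MeanLE.of_le ⟨hint, le_rfl⟩ (hx i).norm.aestronglyMeasurable (fun _ => norm_nonneg _) hle

/-- Takes expectations in the pathwise bound. The factor `n` arises because each agent's initial
norm is bounded by the maximum and each mean subgradient norm by `G`. -/
theorem Network.Follows.meanLE_disagreement (hκ : 0 < κ) (hκ₁ : κ < 1)
    (hN : N.IsValid X' κ B P ξ) (h : N.Follows ℱ R R' α) (hα : ∀ t, 0 ≤ α t)
    (hx : ∀ t i, Measurable (R.x t i)) {G : ℝ}
    (hG : ∀ t i, MeanLE P (fun ω => ‖R.ghat t i ω‖) G) (t : ℕ) (i : V) :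
    MeanLE P (fun ω => ‖R.x t i ω - R.mean t ω‖)
      (disagreement κ (Fintype.card V) B α (Lam P R) G t) := by
  have : Nonempty V := ⟨i⟩
  have := FiniteDimensional.proper ℝ E
  have hn : 1 ≤ Fintype.card V := Fintype.card_pos
  have hθ := (theta_mem hκ hκ₁ hn hN.mixing.one_le).1
  have hΓ := Gam_pos hκ hκ₁ hn
  have hmean : Measurable (R.mean t) :=
    (Finset.measurable_fun_sum Finset.univ fun j _ => hx t j).const_smul (1 / (Fintype.card V : ℝ))
  refine MeanLE.of_le ?_ ((hx t i).sub hmean).norm.aestronglyMeasurable (fun _ => norm_nonneg _)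
    fun ω => h.norm_x_sub_mean_le hκ hκ₁ hN hα t i ω
  have h1 : MeanLE P (fun ω => ∑ j, ‖R.x 0 j ω‖) (∑ _j : V, Lam P R) := MeanLE.sum fun j _ =>
    meanLE_norm_le_iSup hN.isCompact (fun j => hx 0 j) (fun j ω => h.x_mem 0 j ω) j
  have h2 : ∀ s, MeanLE P (fun ω => ∑ j, α s * ‖R.ghat s j ω‖) (∑ _j : V, α s * G) := fun s =>
    MeanLE.sum fun j _ => (hG s j).const_mul (hα s)
  refine ((((h1.const_mul (pow_nonneg hθ.le t)).add (MeanLE.sum fun s _ =>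
    (h2 s).const_mul (pow_nonneg hθ.le (t - 1 - s)))).const_mul hΓ.le)).weaken (le_of_eq ?_)
  simp only [disagreement, Finset.sum_const, Finset.card_univ, nsmul_eq_mul, mul_add,
    Finset.mul_sum]
  congr 1
  · ring
  · exact Finset.sum_congr rfl fun s _ => by ring

end Disagreement

/-! ### Telescoped mirror descent -/

section Descent

variable {Ω : Type*} {d : ℕ} {E F V V' : Type*}
  [NormedAddCommGroup E] [NormedSpace ℝ E]
  [NormedAddCommGroup F] [NormedSpace ℝ F] [Fintype V] [Fintype V']

theorem stepSize_pos {η : ℝ} (hη : 0 < η) (t : ℕ) : 0 < stepSize η t := by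
  unfold stepSize; positivity

/-- Averaging does not increase the total divergence from a fixed point. -/
theorem sum_bregman_mean_le {κ : ℝ} (hκ : 0 < κ) {B : ℕ} {edge : ℕ → V → V → Prop}
    {W : ℕ → Matrix V V ℝ} (h : IsMixing κ B edge W) {X : Set E} {ψ : E → ℝ} {x : E}
    (hconv : ConvexOn ℝ X fun y => bregman X ψ x y) {y : V → E} (hy : ∀ j, y j ∈ X) (t : ℕ) :
    ∑ i, bregman X ψ x (∑ j, W t i j • y j) ≤ ∑ j, bregman X ψ x (y j) := by
  calc ∑ i, bregman X ψ x (∑ j, W t i j • y j)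
      ≤ ∑ i, ∑ j, W t i j * bregman X ψ x (y j) := Finset.sum_le_sum fun i _ => by
        simpa using hconv.map_sum_le (t := Finset.univ) (w := W t i) (p := y)
          (fun j _ => h.nonneg hκ t i j) (h.row_sum t i) fun j _ => hy j
    _ = ∑ j, bregman X ψ x (y j) := by
        rw [Finset.sum_comm]
        simp only [← Finset.sum_mul, h.col_sum, one_mul]

variable [mΩ : MeasurableSpace Ω] [MeasurableSpace E]
  {N : Network E F V V' d} {X' : Set F} {κ : ℝ} {B : ℕ} {P : Measure Ω} {ξ : Ω → Fin d → ℝ}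
  {R : Run Ω E V d} {R' : Run Ω F V' d} {ℱ : ℕ → MeasurableSpace Ω} {η : ℝ}

/-- The telescoped descent inequality of mirror descent with step sizes `1 / (η (t + 1))`. -/
theorem Network.Follows.sum_descent (hκ : 0 < κ) (hN : N.IsValid X' κ B P ξ)
    (hη : 0 < η) (h : N.Follows ℱ R R' (stepSize η)) (hdiv : N.RegularDivergence) {x : E}
    (hx : x ∈ N.X) (ω : Ω) (T : ℕ) :
    ∑ t ∈ Finset.range T, ∑ j, (R.ghat t j ω (N.v R t j ω - x) -
        η * bregman N.X N.ψ x (N.v R t j ω)) + η * T * ∑ j, bregman N.X N.ψ x (R.x T j ω) ≤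
      ∑ t ∈ Finset.range T, ∑ j, stepSize η t / 2 * ‖R.ghat t j ω‖ ^ 2 := by
  induction T with
  | zero => simp
  | succ t ih =>
    rw [Finset.sum_range_succ, Finset.sum_range_succ]
    -- The descent inequality multiplied by `η (t + 1) = 1 / α(t)`. Subtracting `η D(x, v)` leaves
    -- weight `η t` on `D(x, v)`, which is the weight carried by `D(x, x(t))` from the preceding
    -- step, and `0` at `t = 0`.
    have hstep : ∀ j, R.ghat t j ω (N.v R t j ω - x) - η * bregman N.X N.ψ x (N.v R t j ω) ≤
        η * t * bregman N.X N.ψ x (N.v R t j ω) -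
          η * ((t : ℝ) + 1) * bregman N.X N.ψ x (R.x (t + 1) j ω) +
          stepSize η t / 2 * ‖R.ghat t j ω‖ ^ 2 := by
      intro j
      have hα := stepSize_pos hη t
      have h1 := (h.update t j ω).descent hN.differentiable_reg hN.strongConvex_reg
        (hN.v_mem hκ h.x_mem t j ω) hα.le hx
      have hc : 0 < η * ((t : ℝ) + 1) := by positivity
      have hcα : η * ((t : ℝ) + 1) * stepSize η t = 1 := by
        unfold stepSize; field_simp
      have h2 := mul_le_mul_of_nonneg_left h1 hc.le
      have h3 : η * ((t : ℝ) + 1) * (stepSize η t * R.ghat t j ω (N.v R t j ω - x)) =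
          R.ghat t j ω (N.v R t j ω - x) := by rw [← mul_assoc, hcα, one_mul]
      have h4 : η * ((t : ℝ) + 1) * (stepSize η t ^ 2 * ‖R.ghat t j ω‖ ^ 2 / 2) =
          stepSize η t / 2 * ‖R.ghat t j ω‖ ^ 2 := by
        calc _ = (η * ((t : ℝ) + 1) * stepSize η t) * (stepSize η t / 2 * ‖R.ghat t j ω‖ ^ 2) := by
              ring
          _ = _ := by rw [hcα, one_mul]
      rw [h3, mul_add, mul_sub, h4] at h2
      linarith
    have hsum := Finset.sum_le_sum fun j (_ : j ∈ Finset.univ) => hstep j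
    rw [Finset.sum_add_distrib, Finset.sum_sub_distrib (f := fun j => η * t *
      bregman N.X N.ψ x (N.v R t j ω)), ← Finset.mul_sum, ← Finset.mul_sum] at hsum
    have hmix := mul_le_mul_of_nonneg_left (sum_bregman_mean_le hκ hN.mixing
      (hdiv.convex_right x hx) (fun j => h.x_mem t j ω) t) (by positivity : 0 ≤ η * (t : ℝ))
    have hv : ∑ i, bregman N.X N.ψ x (∑ j, N.W t i j • R.x t j ω) =
      ∑ j, bregman N.X N.ψ x (N.v R t j ω) := rfl
    rw [hv] at hmix
    push_cast
    linarith

/-- Regret at the averaged estimates, along a path on which the oracle is correct. -/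
theorem Network.Follows.sum_cost_sub_le (hκ : 0 < κ) (hN : N.IsValid X' κ B P ξ)
    (hη : 0 < η) (h : N.Follows ℱ R R' (stepSize η)) (hdiv : N.RegularDivergence)
    (hsc : ∀ i, ∀ y ∈ X', StronglyConvexWrt N.O N.X N.ψ η (fun x => N.cost P ξ i x y))
    (hu : ∀ t i ω, N.u R' t i ω ∈ X') {x : E} (hx : x ∈ N.X) {ω : Ω}
    (hg : ∀ t i, R.g t i ω ∈ subdiff N.O (fun x => N.cost P ξ i x (N.u R' t i ω)) (N.v R t i ω))
    (T : ℕ) :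
    ∑ t ∈ Finset.range T, ∑ j, (N.cost P ξ j (N.v R t j ω) (N.u R' t j ω) -
        N.cost P ξ j x (N.u R' t j ω)) ≤
      ∑ t ∈ Finset.range T, ∑ j, (stepSize η t / 2 * ‖R.ghat t j ω‖ ^ 2 +
        (R.g t j ω - R.ghat t j ω) (N.v R t j ω - x)) := by
  have h1 := h.sum_descent hκ hN hη hdiv hx ω T
  have h2 : 0 ≤ η * T * ∑ j, bregman N.X N.ψ x (R.x T j ω) :=
    mul_nonneg (by positivity) (Finset.sum_nonneg fun j _ =>
      bregman_nonneg hN.differentiable_reg hN.strongConvex_reg hx (h.x_mem T j ω))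
  have h3 : ∑ t ∈ Finset.range T, ∑ j, (N.cost P ξ j (N.v R t j ω) (N.u R' t j ω) -
        N.cost P ξ j x (N.u R' t j ω)) ≤
      ∑ t ∈ Finset.range T, ∑ j, ((R.ghat t j ω (N.v R t j ω - x) -
        η * bregman N.X N.ψ x (N.v R t j ω)) +
        (R.g t j ω - R.ghat t j ω) (N.v R t j ω - x)) := by
    refine Finset.sum_le_sum fun t _ => Finset.sum_le_sum fun j _ => ?_
    -- Strong convexity at `v` gives `f(v) - f(x) ≤ g(v - x) - η D(x, v)`; then split `g = ĝ + (g -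
    -- ĝ)`.
    have := hsc j _ (hu t j ω) x hx _ (hN.v_mem hκ h.x_mem t j ω) _ (hg t j)
    simp only [sub_apply, map_sub] at this ⊢
    linarith
  simp only [Finset.sum_add_distrib] at h3 ⊢
  linarith

end Descent

end DSMD

namespace DSMD

/-! ### From averaged estimates to the regret of an agent -/

section Regret

variable {Ω : Type*} [mΩ : MeasurableSpace Ω] {d : ℕ} {E F V V' : Type*}
  [NormedAddCommGroup E] [NormedSpace ℝ E]
  [NormedAddCommGroup F] [NormedSpace ℝ F] [Fintype V] [Fintype V']
  {N : Network E F V V' d} {X' : Set F} {κ : ℝ} {B : ℕ} {P : Measure Ω} {ξ : Ω → Fin d → ℝ}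
  {R : Run Ω E V d} {R' : Run Ω F V' d} {ℱ : ℕ → MeasurableSpace Ω} {η L : ℝ}

theorem norm_sum_smul_sub_le {ι : Type*} [Fintype ι] {w : ι → ℝ} (hw : ∀ i, 0 ≤ w i)
    (hw1 : ∑ i, w i = 1) (x : ι → E) (c : E) : ‖∑ i, w i • x i - c‖ ≤ ∑ i, w i * ‖x i - c‖ := by
  have : ∑ i, w i • x i - c = ∑ i, w i • (x i - c) := by
    simp only [smul_sub, Finset.sum_sub_distrib, ← Finset.sum_smul, hw1, one_smul]
  rw [this]
  refine (norm_sum_le _ _).trans (Finset.sum_le_sum fun i _ => ?_)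
  rw [norm_smul, Real.norm_of_nonneg (hw i)]

/-- The cost of the disagreement in the two networks. -/
noncomputable def Network.mismatch (N : Network E F V V' d) (R : Run Ω E V d) (R' : Run Ω F V' d)
    (L : ℝ) (t : ℕ) (i : V) (ω : Ω) : ℝ :=
  L * ((‖R.x t i ω - R.mean t ω‖ + ∑ j, 1 / (Fintype.card V : ℝ) *
      ∑ k, N.W t j k * ‖R.x t k ω - R.mean t ω‖) +
    2 * (∑ k, N.C t i k * ‖R'.x t k ω - R'.mean t ω‖ + ∑ j, 1 / (Fintype.card V : ℝ) *
      ∑ k, N.C t j k * ‖R'.x t k ω - R'.mean t ω‖))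

theorem sum_inv_card [Nonempty V] : ∑ _j : V, 1 / (Fintype.card V : ℝ) = 1 := by
  simp

/-- Passage from the agent's own estimates to the averaged estimates of all agents. -/
theorem Network.avgCost_sub_le (hκ : 0 < κ) (hN : N.IsValid X' κ B P ξ) (hL : 0 ≤ L)
    (hLip : N.LipschitzCosts X' P ξ L) (hR : ∀ t i ω, R.x t i ω ∈ N.X)
    (hu : ∀ t i ω, N.u R' t i ω ∈ X') {x : E} (hx : x ∈ N.X) (t : ℕ) (i : V) (ω : Ω) :
    N.avgCost P ξ (R.x t i ω) (N.u R' t i ω) - N.avgCost P ξ x (N.u R' t i ω) ≤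
      1 / (Fintype.card V : ℝ) * ∑ j, (N.cost P ξ j (N.v R t j ω) (N.u R' t j ω) -
        N.cost P ξ j x (N.u R' t j ω)) + N.mismatch R R' L t i ω := by
  have : Nonempty V := ⟨i⟩
  have hn : (0 : ℝ) < Fintype.card V := by exact_mod_cast Fintype.card_pos
  have hv : ∀ j, ‖N.v R t j ω - R.mean t ω‖ ≤ ∑ k, N.W t j k * ‖R.x t k ω - R.mean t ω‖ :=
    fun j => norm_sum_smul_sub_le (hN.mixing.nonneg hκ t j) (hN.mixing.row_sum t j) _ _
  have hu' : ∀ j, ‖N.u R' t j ω - R'.mean t ω‖ ≤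
      ∑ k, N.C t j k * ‖R'.x t k ω - R'.mean t ω‖ :=
    fun j => norm_sum_smul_sub_le (hN.crossMixing.nonneg t j) (hN.crossMixing.row_sum t j) _ _
  have hj : ∀ j, N.cost P ξ j (R.x t i ω) (N.u R' t i ω) - N.cost P ξ j x (N.u R' t i ω) ≤
      (N.cost P ξ j (N.v R t j ω) (N.u R' t j ω) - N.cost P ξ j x (N.u R' t j ω)) +
      L * ((‖R.x t i ω - R.mean t ω‖ + ∑ k, N.W t j k * ‖R.x t k ω - R.mean t ω‖) +
        2 * (∑ k, N.C t i k * ‖R'.x t k ω - R'.mean t ω‖ +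
          ∑ k, N.C t j k * ‖R'.x t k ω - R'.mean t ω‖)) := by
    intro j
    have h1 := (abs_le.1 (hLip.lipschitz j _ (hR t i ω) _ (hN.v_mem hκ hR t j ω) _ (hu t i ω) _
      (hu t j ω))).2
    -- Replacing `u_i` by `u_j` also changes the competitor's cost, whence the factor `2` on the
    -- opposing network's disagreement.
    have h2 := (abs_le.1 (hLip.lipschitz j _ hx _ hx _ (hu t i ω) _ (hu t j ω))).1
    rw [sub_self, norm_zero, zero_add] at h2
    have h3 : ‖R.x t i ω - N.v R t j ω‖ ≤
        ‖R.x t i ω - R.mean t ω‖ + ‖N.v R t j ω - R.mean t ω‖ := by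
      rw [norm_sub_rev (N.v R t j ω)]; exact norm_sub_le_norm_sub_add_norm_sub _ _ _
    have h4 : ‖N.u R' t i ω - N.u R' t j ω‖ ≤
        ‖N.u R' t i ω - R'.mean t ω‖ + ‖N.u R' t j ω - R'.mean t ω‖ := by
      rw [norm_sub_rev (N.u R' t j ω)]; exact norm_sub_le_norm_sub_add_norm_sub _ _ _
    have h5 := mul_le_mul_of_nonneg_left (h3.trans (add_le_add_right (hv j) _)) hL
    have h6 := mul_le_mul_of_nonneg_left (h4.trans (add_le_add (hu' i) (hu' j))) hL
    linarith
  unfold Network.avgCost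
  rw [← mul_sub, ← Finset.sum_sub_distrib]
  refine (mul_le_mul_of_nonneg_left (Finset.sum_le_sum fun j _ => hj j)
    (by positivity : 0 ≤ 1 / (Fintype.card V : ℝ))).trans_eq ?_
  unfold Network.mismatch
  rw [Finset.sum_add_distrib, mul_add, ← Finset.mul_sum]
  congr 1
  simp only [Finset.sum_add_distrib, ← Finset.mul_sum, Finset.sum_const, Finset.card_univ,
    nsmul_eq_mul]
  field_simp

theorem MeanLE.mismatch [IsProbabilityMeasure P] (hκ : 0 < κ) (hN : N.IsValid X' κ B P ξ)
    (hL : 0 ≤ L) {t : ℕ} {δ δ' : ℝ}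
    (hδ : ∀ i, MeanLE P (fun ω => ‖R.x t i ω - R.mean t ω‖) δ)
    (hδ' : ∀ i, MeanLE P (fun ω => ‖R'.x t i ω - R'.mean t ω‖) δ') (i : V) :
    MeanLE P (N.mismatch R R' L t i) (L * ((δ + δ) + 2 * (δ' + δ'))) := by
  have : Nonempty V := ⟨i⟩
  have hW := fun j => MeanLE.weighted (hN.mixing.nonneg hκ t j) (hN.mixing.row_sum t j) hδ
  have hC := fun j => MeanLE.weighted (hN.crossMixing.nonneg t j) (hN.crossMixing.row_sum t j) hδ'
  have hn : ∀ _j : V, 0 ≤ 1 / (Fintype.card V : ℝ) := fun _ => by positivity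
  exact ((((hδ i).add (MeanLE.weighted hn sum_inv_card hW)).add
    (((hC i).add (MeanLE.weighted hn sum_inv_card hC)).const_mul two_pos.le)).const_mul hL)

/-- Lower bound for the regret of a single step. -/
theorem Network.IsValid.neg_le_sum_cost_sub (hκ : 0 < κ) (hN : N.IsValid X' κ B P ξ) (hη : 0 < η)
    (hL : 0 ≤ L) (hLip : N.LipschitzCosts X' P ξ L) (hR : ∀ t i ω, R.x t i ω ∈ N.X)
    (hsc : ∀ i, ∀ y ∈ X', StronglyConvexWrt N.O N.X N.ψ η (fun x => N.cost P ξ i x y))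
    (hu : ∀ t i ω, N.u R' t i ω ∈ X') {x : E} (hx : x ∈ N.X) {ω : Ω} {t : ℕ}
    (hg : ∀ i, R.g t i ω ∈ subdiff N.O (fun x => N.cost P ξ i x (N.u R' t i ω)) (N.v R t i ω)) :
    -(Fintype.card V * (4 * L ^ 2 / η)) ≤ ∑ j, (N.cost P ξ j (N.v R t j ω) (N.u R' t j ω) -
        N.cost P ξ j x (N.u R' t j ω)) := by
  have hj : ∀ j, -(4 * L ^ 2 / η) ≤ N.cost P ξ j (N.v R t j ω) (N.u R' t j ω) -
        N.cost P ξ j x (N.u R' t j ω) := by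
    intro j
    have hv := hN.v_mem hκ hR t j ω
    have hown := fun x hx x' hx' => hLip.lipschitz_own j x hx x' hx' _ (hu t j ω)
    -- Strong convexity and the Lipschitz bound put `x` within `4 L / η` of `v`, so the bound does
    -- not involve the diameter of `X`.
    have h1 := norm_sub_le_of_stronglyConvexWrt hN.differentiable_reg hN.strongConvex_reg hη
      (hsc j _ (hu t j ω)) (fun x hx x' hx' => hown x (hN.subset hx) x' (hN.subset hx')) hv (hg j)
      (norm_le_of_mem_subdiff hN.isOpen hL hown (hN.subset hv) (hg j)) hx
    have h2 := (abs_le.1 (hown _ (hN.subset hx) _ (hN.subset hv))).2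
    have h3 := mul_le_mul_of_nonneg_left h1 hL
    have h4 : L * (4 * L / η) = 4 * L ^ 2 / η := by ring
    linarith
  simpa using Finset.sum_le_sum fun j (_ : j ∈ Finset.univ) => hj j

variable [FiniteDimensional ℝ E] [MeasurableSpace E] [BorelSpace E]
  [FiniteDimensional ℝ F] [MeasurableSpace F] [BorelSpace F]

theorem Network.IsValid.integrable_avgCost [IsProbabilityMeasure P] (hN : N.IsValid X' κ B P ξ)
    (hX' : IsCompact X') {y : Ω → E} {z : Ω → F} (hy : Measurable y) (hz : Measurable z)
    (hyX : ∀ ω, y ω ∈ N.X) (hzX : ∀ ω, z ω ∈ X') :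
    Integrable (fun ω => N.avgCost P ξ (y ω) (z ω)) P := by
  have := FiniteDimensional.proper ℝ E
  have := FiniteDimensional.proper ℝ F
  refine (integrable_finsetSum _ fun i _ => ?_).const_mul _
  obtain ⟨C, hC⟩ := (hN.isCompact.prod hX').exists_bound_of_continuousOn (hN.continuous_cost i)
  exact (integrable_const C).mono' (measurable_comp_of_continuousOn (hN.continuous_cost i)
    (hy.prodMk hz) fun ω => ⟨hyX ω, hzX ω⟩).aestronglyMeasurable
    (Eventually.of_forall fun ω => hC (y ω, z ω) ⟨hyX ω, hzX ω⟩)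

theorem sum_stepSize {η : ℝ} (T : ℕ) :
    ∑ t ∈ Finset.range T, stepSize η t = 1 / η * ∑ t ∈ Finset.range T, 1 / ((t : ℝ) + 1) := by
  rw [Finset.mul_sum]
  exact Finset.sum_congr rfl fun t _ => by unfold stepSize; rw [one_div_mul_one_div]

/-- The regret of an agent against a fixed action. -/
theorem Network.Follows.integral_regret_le [IsProbabilityMeasure P] {N' : Network F E V' V d}
    {B' : ℕ} {ν ν' : ℝ} (hκ : 0 < κ) (hκ₁ : κ < 1) (hN : N.IsValid N'.X κ B P ξ)
    (hN' : N'.IsValid N.X κ B' P ξ) (hη : 0 < η)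
    (hℱ : ∀ t, ℱ t ≤ mΩ) (hmono : Monotone ℱ) (h0 : ∀ i, Measurable[ℱ 0] (R.x 0 i))
    (h0' : ∀ i, Measurable[ℱ 0] (R'.x 0 i))
    (hR : N.Follows ℱ R R' (stepSize η)) (hR' : N'.Follows ℱ R' R (stepSize η))
    (hL : 0 < L) (hν : 0 < ν) (hν' : 0 < ν')
    (hLip : N.LipschitzCosts N'.X P ξ L) (hLip' : N'.LipschitzCosts N.X P ξ L)
    (hor : N.UnbiasedOracle P ξ ℱ R R' ν) (hor' : N'.UnbiasedOracle P ξ ℱ R' R ν')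
    (hdiv : N.RegularDivergence)
    (hsc : ∀ i, ∀ y ∈ N'.X, StronglyConvexWrt N.O N.X N.ψ η (fun x => N.cost P ξ i x y))
    {x : E} (hx : x ∈ N.X) (i : V) (T : ℕ) :
    (∫ ω, ∑ t ∈ Finset.Icc 1 T, N.avgCost P ξ (R.x t i ω) (N.u R' t i ω) ∂P) -
      ∫ ω, ∑ t ∈ Finset.Icc 1 T, N.avgCost P ξ x (N.u R' t i ω) ∂P ≤
    4 * L ^ 2 / η + (L + ν) ^ 2 / 2 * ∑ t ∈ Finset.range (T + 1), stepSize η t +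
      L * (2 * ∑ t ∈ Finset.Icc 1 T,
          disagreement κ (Fintype.card V) B (stepSize η) (Lam P R) (L + ν) t +
        4 * ∑ t ∈ Finset.Icc 1 T,
          disagreement κ (Fintype.card V') B' (stepSize η) (Lam P R') (L + ν') t) := by
  have : Nonempty V := ⟨i⟩
  have hn : (0 : ℝ) < Fintype.card V := by exact_mod_cast Fintype.card_pos
  have hα := fun t => (stepSize_pos hη t).le
  have hu := hN.u_mem hN'.convex hR'.x_mem
  have hu' := hN'.u_mem hN.convex hR.x_mem
  have hxm := fun t i => (hR.measurable_x hκ hN hmono h0 t i)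
  have hxm' := fun t i => (hR'.measurable_x hκ hN' hmono h0' t i)
  have hgL := hor.ae_norm_g_le hκ hN hLip hL.le hR.x_mem hu
  have hgL' := hor'.ae_norm_g_le hκ hN' hLip' hL.le hR'.x_mem hu'
  have hD := hR.meanLE_disagreement hκ hκ₁ hN hα (fun t i => (hxm t i).mono (hℱ t) le_rfl)
    fun t i => ⟨(hor.integrable t i).norm, hor.integral_norm_ghat_le hν hℱ (hgL t i)⟩
  have hD' := hR'.meanLE_disagreement hκ hκ₁ hN' hα (fun t i => (hxm' t i).mono (hℱ t) le_rfl)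
    fun t i => ⟨(hor'.integrable t i).norm, hor'.integral_norm_ghat_le hν' hℱ (hgL' t i)⟩
  obtain ⟨C, hC⟩ := hN.isCompact.exists_bound_of_continuousOn
    (f := fun y => y - x) (continuousOn_id.sub continuousOn_const)
  have hnoise : ∀ t j, MeanLE P
      (fun ω => (R.g t j ω - R.ghat t j ω) (N.v R t j ω - x)) 0 := fun t j => by
    obtain ⟨h1, h2⟩ := hor.integral_noise_apply hℱ t j
      ((Network.measurable_v (hxm t) j).sub_const x)
      fun ω => hC _ (hN.v_mem hκ hR.x_mem t j ω)
    exact ⟨h1, h2.le⟩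
  have hsq : ∀ t j, MeanLE P (fun ω => ‖R.ghat t j ω‖ ^ 2) ((L + ν) ^ 2) := fun t j =>
    hor.sq_norm_ghat_le hν hL.le hℱ (hgL t j)
  -- A pathwise upper bound for the regret, whose mean is assembled term by term; the noise
  -- contributes `0`.
  have hmain : MeanLE P (fun ω => 1 / (Fintype.card V : ℝ) * (Fintype.card V * (4 * L ^ 2 / η) +
      ∑ t ∈ Finset.range (T + 1), ∑ j, (stepSize η t / 2 * ‖R.ghat t j ω‖ ^ 2 +
        (R.g t j ω - R.ghat t j ω) (N.v R t j ω - x))) +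
      ∑ t ∈ Finset.Icc 1 T, N.mismatch R R' L t i ω) _ :=
    (((MeanLE.const _).add (MeanLE.sum fun t _ => MeanLE.sum fun j _ =>
      ((hsq t j).const_mul (half_pos (stepSize_pos hη t)).le).add (hnoise t j))).const_mul
        (by positivity)).add (MeanLE.sum fun t _ => MeanLE.mismatch hκ hN hL.le (hD t) (hD' t) i)
  have hint1 : Integrable (fun ω => ∑ t ∈ Finset.Icc 1 T,
      N.avgCost P ξ (R.x t i ω) (N.u R' t i ω)) P :=
    integrable_finsetSum _ fun t _ => hN.integrable_avgCost hN'.isCompact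
      ((hxm t i).mono (hℱ t) le_rfl)
      ((Network.measurable_u (hxm' t) i).mono (hℱ t) le_rfl) (hR.x_mem t i) (hu t i)
  have hint2 : Integrable (fun ω => ∑ t ∈ Finset.Icc 1 T, N.avgCost P ξ x (N.u R' t i ω)) P :=
    integrable_finsetSum _ fun t _ => hN.integrable_avgCost hN'.isCompact measurable_const
      ((Network.measurable_u (hxm' t) i).mono (hℱ t) le_rfl) (fun _ => hx) (hu t i)
  have hall : ∀ᵐ ω ∂P, ∀ t j,
      R.g t j ω ∈ subdiff N.O (fun x => N.cost P ξ j x (N.u R' t j ω)) (N.v R t j ω) :=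
    ae_all_iff.2 fun t => ae_all_iff.2 fun j => hor.g_mem t j
  rw [← integral_sub hint1 hint2]
  refine (integral_mono_ae (hint1.sub hint2) hmain.1 ?_).trans (hmain.2.trans_eq ?_)
  · filter_upwards [hall] with ω hω
    have h1 := hR.sum_cost_sub_le hκ hN hη hdiv hsc hu hx hω (T + 1)
    have h2 := hN.neg_le_sum_cost_sub hκ hη hL.le hLip hR.x_mem hsc hu hx (hω 0)
    -- Descent is summed from `t = 0`, but the regret starts at `t = 1`; the term `t = 0` is split
    -- off and bounded below by `h2`, at the cost of `4 L² / η`.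
    rw [Finset.sum_range_succ', ← sum_Icc_one_eq_sum_range (fun t => ∑ j,
      (N.cost P ξ j (N.v R t j ω) (N.u R' t j ω) - N.cost P ξ j x (N.u R' t j ω)))] at h1
    have h3 := Finset.sum_le_sum fun t (_ : t ∈ Finset.Icc 1 T) =>
      Network.avgCost_sub_le hκ hN hL.le hLip hR.x_mem hu hx t i ω
    rw [Finset.sum_sub_distrib, Finset.sum_add_distrib, ← Finset.mul_sum] at h3
    refine h3.trans (add_le_add_left (mul_le_mul_of_nonneg_left ?_ (by positivity)) _)
    linarith
  · simp only [Finset.sum_add_distrib, Finset.sum_const, Finset.card_univ, nsmul_eq_mul,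
      add_zero, ← Finset.mul_sum, ← Finset.sum_mul, ← Finset.sum_div]
    field_simp
    ring

omit [Fintype V] [FiniteDimensional ℝ E] [MeasurableSpace E] [BorelSpace E] in
theorem Lam_nonneg (P : Measure Ω) (R : Run Ω E V d) : 0 ≤ Lam P R :=
  integral_nonneg fun _ => Real.iSup_nonneg fun _ => norm_nonneg _

/-- The bound against a fixed action is uniform in that action, so it passes to the infimum; the
rest compares constants. -/
theorem Network.Follows.pseudoRegret_le [IsProbabilityMeasure P] {N' : Network F E V' V d}
    {B' : ℕ} {ν ν' : ℝ} [Nonempty V'] (hκ : 0 < κ) (hκ₁ : κ < 1) (hN : N.IsValid N'.X κ B P ξ)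
    (hN' : N'.IsValid N.X κ B' P ξ) (hη : 0 < η)
    (hℱ : ∀ t, ℱ t ≤ mΩ) (hmono : Monotone ℱ) (h0 : ∀ i, Measurable[ℱ 0] (R.x 0 i))
    (h0' : ∀ i, Measurable[ℱ 0] (R'.x 0 i))
    (hR : N.Follows ℱ R R' (stepSize η)) (hR' : N'.Follows ℱ R' R (stepSize η))
    (hL : 0 < L) (hν : 0 < ν) (hν' : 0 < ν')
    (hLip : N.LipschitzCosts N'.X P ξ L) (hLip' : N'.LipschitzCosts N.X P ξ L)
    (hor : N.UnbiasedOracle P ξ ℱ R R' ν) (hor' : N'.UnbiasedOracle P ξ ℱ R' R ν')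
    (hdiv : N.RegularDivergence)
    (hsc : ∀ i, ∀ y ∈ N'.X, StronglyConvexWrt N.O N.X N.ψ η (fun x => N.cost P ξ i x y))
    (i : V) {T : ℕ} (hT : 1 ≤ T) :
    pseudoRegret N P ξ R R' i T ≤
      (1 / η) * (logCoeff L ν κ (Fintype.card V) B + logCoeff L ν' κ (Fintype.card V') B') *
          (1 + Real.log T) +
        4 * L * (constCoeff (Lam P R) κ (Fintype.card V) B +
          constCoeff (Lam P R') κ (Fintype.card V') B') := by
  have : Nonempty V := ⟨i⟩
  have hn : 1 ≤ Fintype.card V := Fintype.card_pos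
  have hn' : 1 ≤ Fintype.card V' := Fintype.card_pos
  have hα := fun t => (stepSize_pos hη t).le
  obtain ⟨ω₀⟩ : Nonempty Ω := nonempty_of_isProbabilityMeasure P
  have hΛ := Lam_nonneg P R
  have hΛ' := Lam_nonneg P R'
  set ρ := 1 + Real.log T with hρ
  have hρ1 : 1 ≤ ρ := by
    have := Real.log_nonneg (by exact_mod_cast hT : (1 : ℝ) ≤ T)
    linarith
  have hS : ∑ s ∈ Finset.range T, stepSize η s ≤ 1 / η * ρ := by
    rw [sum_stepSize]
    exact mul_le_mul_of_nonneg_left sum_inv_succ_le (by positivity)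
  -- The sum over `0, …, T` has one term more than the harmonic bound covers; that term is at most
  -- `1 / η`, whence the factor `2`.
  have hS1 : ∑ s ∈ Finset.range (T + 1), stepSize η s ≤ 2 * (1 / η * ρ) := by
    rw [Finset.sum_range_succ]
    have h1 : stepSize η T ≤ 1 / η * ρ := by
      have h2 : stepSize η T ≤ 1 / η := by
        unfold stepSize
        apply one_div_le_one_div_of_le hη
        nlinarith [(Nat.cast_nonneg T : (0 : ℝ) ≤ T)]
      exact h2.trans (le_mul_of_one_le_right (by positivity) hρ1)
    linarith
  have key : ∀ {n B : ℕ} {Λ ν : ℝ}, 1 ≤ n → 1 ≤ B → 0 ≤ Λ → 0 < ν →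
      0 ≤ n * Gam κ n / (1 - theta κ n B) ∧
      ∑ t ∈ Finset.Icc 1 T, disagreement κ n B (stepSize η) Λ (L + ν) t ≤
        n * Gam κ n / (1 - theta κ n B) * (Λ + (L + ν) * (1 / η * ρ)) := by
    intro n B Λ ν hn hB hΛ hν
    have hθ := (theta_mem hκ hκ₁ hn hB).2
    have hΓ := Gam_pos hκ hκ₁ hn
    have hG : 0 ≤ n * Gam κ n / (1 - theta κ n B) :=
      div_nonneg (by positivity) (by linarith)
    exact ⟨hG, (sum_disagreement_le hκ hκ₁ hn hB hα hΛ (by positivity) T).trans (by gcongr)⟩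
  obtain ⟨hG, hdis⟩ := key hn hN.mixing.one_le hΛ hν
  obtain ⟨hG', hdis'⟩ := key hn' hN'.mixing.one_le hΛ' hν'
  unfold pseudoRegret
  rw [sub_le_comm]
  refine le_csInf (Set.Nonempty.image _ ⟨_, hR.x_mem 0 i ω₀⟩) ?_
  rintro _ ⟨x, hx, rfl⟩
  rw [sub_le_comm]
  refine (hR.integral_regret_le hκ hκ₁ hN hN' hη hℱ hmono h0 h0' hR' hL hν hν' hLip hLip' hor hor'
    hdiv hsc hx i T).trans ?_
  have e1 : logCoeff L ν κ (Fintype.card V) B = (L + ν) * (9 * L + ν + 4 * L *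
      (Fintype.card V * Gam κ (Fintype.card V) / (1 - theta κ (Fintype.card V) B))) := by
    unfold logCoeff; ring
  have e2 : logCoeff L ν' κ (Fintype.card V') B' = (L + ν') * (9 * L + ν' + 4 * L *
      (Fintype.card V' * Gam κ (Fintype.card V') / (1 - theta κ (Fintype.card V') B'))) := by
    unfold logCoeff; ring
  have e3 : constCoeff (Lam P R) κ (Fintype.card V) B =
      Fintype.card V * Gam κ (Fintype.card V) / (1 - theta κ (Fintype.card V) B) * Lam P R := by
    unfold constCoeff; ring
  have e4 : constCoeff (Lam P R') κ (Fintype.card V') B' =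
      Fintype.card V' * Gam κ (Fintype.card V') / (1 - theta κ (Fintype.card V') B') *
        Lam P R' := by
    unfold constCoeff; ring
  rw [e1, e2, e3, e4]
  set G := (Fintype.card V : ℝ) * Gam κ (Fintype.card V) / (1 - theta κ (Fintype.card V) B)
  set G' := (Fintype.card V' : ℝ) * Gam κ (Fintype.card V') / (1 - theta κ (Fintype.card V') B')
  set r := 1 / η * ρ with hr
  have hη1 : 1 / η ≤ r := le_mul_of_one_le_right (by positivity) hρ1
  have hr0 : 0 ≤ r := by positivity
  have b1 : 4 * L ^ 2 / η ≤ 4 * L ^ 2 * r := by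
    calc 4 * L ^ 2 / η = 4 * L ^ 2 * (1 / η) := by ring
      _ ≤ _ := by gcongr
  have b2 : (L + ν) ^ 2 / 2 * ∑ t ∈ Finset.range (T + 1), stepSize η t ≤ (L + ν) ^ 2 * r := by
    calc _ ≤ (L + ν) ^ 2 / 2 * (2 * r) := by gcongr
      _ = _ := by ring
  have b3 := mul_le_mul_of_nonneg_left (add_le_add (mul_le_mul_of_nonneg_left hdis two_pos.le)
    (mul_le_mul_of_nonneg_left hdis' (by norm_num : (0 : ℝ) ≤ 4))) hL.le
  -- The target exceeds the sum of the bounds `b1`, `b2`, `b3` by a nonnegative combination of `c1`,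
  -- …, `c5`.
  have c1 : 0 ≤ L * G * Lam P R := by positivity
  have c2 : 0 ≤ L * G * (L + ν) * r := by positivity
  have c3 : 0 ≤ L * (L + ν) * r := by positivity
  have c4 : 0 ≤ (L + ν') * (9 * L + ν') * r := by positivity
  have c5 : 0 ≤ L * ν * r := by positivity
  have e5 : 1 / η * ((L + ν) * (9 * L + ν + 4 * L * G) + (L + ν') * (9 * L + ν' + 4 * L * G')) * ρ +
      4 * L * (G * Lam P R + G' * Lam P R') =
      ((L + ν) * (9 * L + ν + 4 * L * G) + (L + ν') * (9 * L + ν' + 4 * L * G')) * r +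
      4 * L * (G * Lam P R + G' * Lam P R') := by
    rw [hr]; ring
  rw [e5]
  linarith

end Regret

end DSMD

/-! ### The regret bound and its logarithmic form -/

theorem theorem3 {Ω : Type*} [MeasurableSpace Ω] (P : Measure Ω) [IsProbabilityMeasure P]
    {E₁ E₂ V₁ V₂ : Type*}
    [NormedAddCommGroup E₁] [NormedSpace ℝ E₁] [FiniteDimensional ℝ E₁]
    [MeasurableSpace E₁] [BorelSpace E₁]
    [NormedAddCommGroup E₂] [NormedSpace ℝ E₂] [FiniteDimensional ℝ E₂]
    [MeasurableSpace E₂] [BorelSpace E₂]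
    [Fintype V₁] [Nonempty V₁] [Fintype V₂] [Nonempty V₂]
    {d : ℕ} (ξ : Ω → Fin d → ℝ) (hξ : Measurable ξ)
    -- the game: two networks with opposite average costs
    (N₁ : DSMD.Network E₁ E₂ V₁ V₂ d) (N₂ : DSMD.Network E₂ E₁ V₂ V₁ d)
    (κ : ℝ) (hκ₀ : 0 < κ) (hκ₁ : κ < 1) (B₁ B₂ : ℕ)
    (hN₁ : N₁.IsValid N₂.X κ B₁ P ξ) (hN₂ : N₂.IsValid N₁.X κ B₂ P ξ)
    (hzero : ∀ x₁ ∈ N₁.X, ∀ x₂ ∈ N₂.X, N₁.avgCost P ξ x₁ x₂ = -N₂.avgCost P ξ x₂ x₁)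
    -- the algorithm with step sizes `1 / (η (t + 1))`
    (η : ℝ) (hη : 0 < η)
    (R₁ : DSMD.Run Ω E₁ V₁ d) (R₂ : DSMD.Run Ω E₂ V₂ d)
    (hiid : DSMD.IsIIDSample P ξ R₁ R₂)
    (hR₁ : N₁.Follows (DSMD.past R₁ R₂) R₁ R₂ (DSMD.stepSize η))
    (hR₂ : N₂.Follows (DSMD.past R₁ R₂) R₂ R₁ (DSMD.stepSize η))
    -- Lipschitz costs, unbiased subgradients with bounded variance, regular divergences
    (L ν₁ ν₂ : ℝ) (hL : 0 < L) (hν₁ : 0 < ν₁) (hν₂ : 0 < ν₂)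
    (hLip₁ : N₁.LipschitzCosts N₂.X P ξ L) (hLip₂ : N₂.LipschitzCosts N₁.X P ξ L)
    (hor₁ : N₁.UnbiasedOracle P ξ (DSMD.past R₁ R₂) R₁ R₂ ν₁)
    (hor₂ : N₂.UnbiasedOracle P ξ (DSMD.past R₁ R₂) R₂ R₁ ν₂)
    (hdiv₁ : N₁.RegularDivergence) (hdiv₂ : N₂.RegularDivergence)
    -- generalized strong convexity of the costs of the first network
    (hsc : ∀ i, ∀ x₂ ∈ N₂.X,
      DSMD.StronglyConvexWrt N₁.O N₁.X N₁.ψ η (fun x₁ => N₁.cost P ξ i x₁ x₂)) :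
    (∀ i : V₁, ∀ T : ℕ, 1 ≤ T →
      DSMD.pseudoRegret N₁ P ξ R₁ R₂ i T ≤
        (1 / η) * (DSMD.logCoeff L ν₁ κ (Fintype.card V₁) B₁ +
            DSMD.logCoeff L ν₂ κ (Fintype.card V₂) B₂) * (1 + Real.log T) +
          4 * L * (DSMD.constCoeff (DSMD.Lam P R₁) κ (Fintype.card V₁) B₁ +
            DSMD.constCoeff (DSMD.Lam P R₂) κ (Fintype.card V₂) B₂)) ∧
    ∃ K : ℝ, ∀ i : V₁, ∀ T : ℕ, 2 ≤ T →
      DSMD.pseudoRegret N₁ P ξ R₁ R₂ i T ≤ K * Real.log T := by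
  have hmain : ∀ i : V₁, ∀ T : ℕ, 1 ≤ T → _ := fun i T hT =>
    hR₁.pseudoRegret_le hκ₀ hκ₁ hN₁ hN₂ hη
      (DSMD.past_le hR₁.measurable_init hR₂.measurable_init hiid.measurable hiid.measurable')
      DSMD.past_mono DSMD.measurable_past_init DSMD.measurable_past_init' hR₂ hL hν₁ hν₂ hLip₁ hLip₂
      hor₁ hor₂ hdiv₁ hsc i hT
  refine ⟨hmain, ?_⟩
  set A := (1 / η) * (DSMD.logCoeff L ν₁ κ (Fintype.card V₁) B₁ +
    DSMD.logCoeff L ν₂ κ (Fintype.card V₂) B₂)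
  set D := 4 * L * (DSMD.constCoeff (DSMD.Lam P R₁) κ (Fintype.card V₁) B₁ +
    DSMD.constCoeff (DSMD.Lam P R₂) κ (Fintype.card V₂) B₂)
  -- For `T ≥ 2` the constant part of `A (1 + log T) + D` is absorbed by `log T ≥ log 2`.
  refine ⟨(|A| + |D|) / Real.log 2 + A, fun i T hT => (hmain i T (by omega)).trans ?_⟩
  have h2 : 0 < Real.log 2 := Real.log_pos (by norm_num)
  have hlog : Real.log 2 ≤ Real.log T := Real.log_le_log two_pos (by exact_mod_cast hT)
  have h3 : |A| + |D| ≤ (|A| + |D|) / Real.log 2 * Real.log T := by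
    rw [div_mul_eq_mul_div, le_div_iff₀ h2]
    exact mul_le_mul_of_nonneg_left hlog (by positivity)
  linarith [le_abs_self A, le_abs_self D]
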